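/- Let $f$ be a nonconstant meromorphic function on $\mathbb C$, and let $a_1,\dots,a_q$ be distinct points of the Riemann sphere $\overline{\mathbb C}=\mathbb C\cup\{\infty\}$. Put $$T_f(r)=\int_1^r\frac{dt}{t}\int_{|z|<t}f^*\omega_{FS},\qquad \overline N_f(r,a)=\int_1^r\frac{\overline n_f(t,a)}{t}\,dt ,$$ where $\omega_{FS}=\frac{\sqrt{-1}}{2\pi}\partial\bar\partial\log(1+|\zeta|^2)$ is the Fubini–Study form, so that $f^*\omega_{FS}=\frac1\pi\frac{|f'|^2}{(1+|f|^2)^2}\,dx\wedge dy$, and $\overline n_f(t,a)$ is the number of distinct points of $\{|z|<t\}$ at which $f$ takes the value $a$ (counted without multiplicity; for $a=\infty$ these are the poles of $f$). Then for every $\delta>0$ $$(q-2)\,T_f(r)\le\sum_{j=1}^q\overline N_f(r,a_j)+O\big(\log T_f(r)+\delta\log r\big)$$ holds for all $r\in(0,\infty)$ outside a set $E_\delta$ of finite Lebesgue measure. Precisely: there is a constant $C>0$, depending only on $f$ and $a_1,\dots,a_q$ and not on $\delta$, such that for every $\delta>0$ there is a Lebesgue measurable set $E_\delta\subset\mathbb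 R$ of finite measure such that for all $r\in(0,\infty)\setminus E_\delta$ one has $T_f(r)>0$ and $$(q-2)\,T_f(r)\le\sum_{j=1}^q\overline N_f(r,a_j)+C\big(\log T_f(r)+\delta\log r\big).$$ -/

import Mathlib

open MeasureTheory Filter Topology Set

/-- A meromorphic function `f` on `ℂ` is nonconstant: it does not agree with a constant outside a
closed discrete set. (The values of a meromorphic `f : ℂ → ℂ` at the points of such a set, for
instance at its poles, carry no information.) -/
def MeromorphicNonconstant (f : ℂ → ℂ) : Prop :=
  ∀ c : ℂ, ¬ f =ᶠ[codiscrete ℂ] fun _ => c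

/-- The meromorphic function `f`, viewed as a map from `ℂ` to the Riemann sphere
`ℂ ∪ {∞}`, takes the value `a` at the point `z`. -/
def TakesValueAt (f : ℂ → ℂ) (a : OnePoint ℂ) (z : ℂ) : Prop :=
  Tendsto (fun w => (f w : OnePoint ℂ)) (𝓝[≠] z) (𝓝 a)

/-- The density, with respect to the Lebesgue measure of the plane, of the pullback `f^* ω_FS`
of the Fubini--Study form `ω_FS = (i / 2π) ∂∂̄ log (1 + |ζ|²)`, of total mass `1` on the sphere:
`f^* ω_FS = (1 / π) |f'|² / (1 + |f|²)² dx ∧ dy`. (The poles of `f` form a null set.) -/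
noncomputable def fubiniStudyDensity (f : ℂ → ℂ) (z : ℂ) : ℝ :=
  (1 / Real.pi) * (‖deriv f z‖ ^ 2 / (1 + ‖f z‖ ^ 2) ^ 2)

/-- The Ahlfors characteristic `T_f(r) = ∫_1^r (dt / t) ∫_{|z| < t} f^* ω_FS`. -/
noncomputable def ahlforsCharacteristic (f : ℂ → ℂ) (r : ℝ) : ℝ :=
  ∫ t in (1 : ℝ)..r, (∫ z in Metric.ball (0 : ℂ) t, fubiniStudyDensity f z) / t

/-- The number of distinct points of the open disc `|z| < t` at which `f` takes the value `a`. -/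
noncomputable def simpleCount (f : ℂ → ℂ) (a : OnePoint ℂ) (t : ℝ) : ℕ :=
  {z : ℂ | z ∈ Metric.ball (0 : ℂ) t ∧ TakesValueAt f a z}.ncard

/-- The simple (truncated) counting function, `∫_1^r (number of distinct a-points in |z| < t) dt/t`. -/
noncomputable def simpleCounting (f : ℂ → ℂ) (a : OnePoint ℂ) (r : ℝ) : ℝ :=
  ∫ t in (1 : ℝ)..r, (simpleCount f a t : ℝ) / t

/-! The proof is the area-form version of Nevanlinna's argument. Let F be a finite set of complex
targets, with ∞ as one further target. Jensen's formula applied to f' and to each f - b, b ∈ F,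
together with a pointwise comparison of divisors (`neg_sum_le_ramificationDivisor`), gives (|F| - 1)
T ≤ ∑ N̄ + (circle average of `logPullback`) + O(1), where T is the Nevanlinna characteristic
(`exists_characteristic_le_circleAverage`). What remains is to show that this average is O(log T + ε
log r).

Twice `logPullback` is the logarithm of the density u of a pulled back singular area form, plus 3
log of `logSize`. By concavity of the logarithm (`circleAverage_logPullback_le`) it suffices to
bound the circle means of u and of `logSize ∘ f`. The second mean is O(T) by the first main theorem.
For the first, Borel's growth lemma used twice (`exists_lintegral_circle_le`) bounds the mean, off a
set of radii of finite measure, by 4 r^ε (1 + H)^4, where H(r) = ∫_1^r (∫_{|z|<t} u) dt/t.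

To see that H = O(T), the area formula turns H into an integral over targets a of the singular
density times a counting function of a-points. The first main theorem bounds that counting function
by T plus an explicit error with a logarithmic singularity at one point b. The density is built so
that it and its product with this error are integrable (`exists_lintegral_singularDensity_le`).

The same area formula with the Fubini–Study weight averages the first main theorem over all targets
and shows that the Ahlfors and Nevanlinna characteristics differ by O(1)
(`exists_abs_ahlforsCharacteristic_sub_le`). Targets added to the given ones, namely ∞ and b, are
removed at the end at the cost of T + O(1) each. -/

/-! ### Logarithmic averages over discs. -/

/-- The weight `log⁺ (r / max 1 |z|)`: it equals `∫_1^r 1_{|z| < t} dt / t` for `r ≥ 1`. -/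
noncomputable def logWeight (r : ℝ) (z : ℂ) : ℝ := Real.posLog (r / max 1 ‖z‖)

lemma logWeight_nonneg (r : ℝ) (z : ℂ) : 0 ≤ logWeight r z := Real.posLog_nonneg

lemma continuous_logWeight (r : ℝ) : Continuous (logWeight r) := by
  unfold logWeight
  have h : ∀ z : ℂ, max 1 ‖z‖ ≠ 0 := fun z => (lt_max_of_lt_left one_pos).ne'
  exact Real.continuous_posLog.comp (continuous_const.div (by fun_prop) h)

lemma logWeight_eq_zero {r : ℝ} (hr : 0 ≤ r) {z : ℂ} (h : r ≤ max 1 ‖z‖) : logWeight r z = 0 := by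
  have h1 : 0 < max 1 ‖z‖ := lt_max_of_lt_left one_pos
  unfold logWeight
  rw [Real.posLog_eq_zero_iff, abs_of_nonneg (by positivity)]
  exact (div_le_one h1).2 h

lemma logWeight_eq_log {r : ℝ} {z : ℂ} (h : max 1 ‖z‖ ≤ r) :
    logWeight r z = Real.log (r / max 1 ‖z‖) := by
  have h1 : 0 < max 1 ‖z‖ := lt_max_of_lt_left one_pos
  have h2 : 1 ≤ r / max 1 ‖z‖ := (one_le_div h1).2 h
  unfold logWeight
  exact Real.posLog_eq_log (by rwa [abs_of_nonneg (by linarith)])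

lemma lintegral_Ioc_indicator_div (r : ℝ) (hr : 1 ≤ r) (z : ℂ) :
    ∫⁻ t in Ioc 1 r, (Ioi ‖z‖).indicator (fun t => ENNReal.ofReal t⁻¹) t
      = ENNReal.ofReal (logWeight r z) := by
  have h1 : 0 < max 1 ‖z‖ := lt_max_of_lt_left one_pos
  rw [setLIntegral_indicator measurableSet_Ioi]
  have : Ioi ‖z‖ ∩ Ioc 1 r = Ioc (max 1 ‖z‖) r := by
    ext t; simp only [mem_inter_iff, mem_Ioi, mem_Ioc, max_lt_iff]; tauto
  rw [this]
  rcases le_total (max 1 ‖z‖) r with h | h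
  · rw [logWeight_eq_log h, ← integral_inv_of_pos h1 (h1.trans_le h),
      intervalIntegral.integral_of_le h, ofReal_integral_eq_lintegral_ofReal]
    · refine (intervalIntegral.intervalIntegrable_inv (f := fun x : ℝ => x)
      (fun x hx => ?_) continuousOn_id).1
      rw [uIcc_of_le h] at hx
      exact (h1.trans_le hx.1).ne'
    · filter_upwards [ae_restrict_mem measurableSet_Ioc] with t ht
      exact inv_nonneg.2 (h1.trans ht.1).le
  · rw [Ioc_eq_empty (not_lt.2 h), logWeight_eq_zero (by linarith) h]; simp

/-- Tonelli: the logarithmic average of the masses of discs is the integral of the weight. -/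
lemma lintegral_measure_ball_div (μ : Measure ℂ) [SFinite μ] (r : ℝ) (hr : 1 ≤ r) :
    ∫⁻ t in Ioc 1 r, μ (Metric.ball 0 t) * ENNReal.ofReal t⁻¹
      = ∫⁻ z, ENNReal.ofReal (logWeight r z) ∂μ := by
  have hm : Measurable (fun p : ℝ × ℂ =>
      (Ioi ‖p.2‖).indicator (fun t => ENNReal.ofReal t⁻¹) p.1) := by
    have : (fun p : ℝ × ℂ => (Ioi ‖p.2‖).indicator (fun t => ENNReal.ofReal t⁻¹) p.1)
        = {p : ℝ × ℂ | ‖p.2‖ < p.1}.indicator (fun p => ENNReal.ofReal p.1⁻¹) := by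
      ext p; simp [indicator]
    rw [this]
    exact (by fun_prop : Measurable fun p : ℝ × ℂ => ENNReal.ofReal p.1⁻¹).indicator
      (measurableSet_lt (by fun_prop) (by fun_prop))
  simp_rw [← lintegral_Ioc_indicator_div r hr]
  rw [lintegral_lintegral_swap (by exact (hm.comp measurable_swap).aemeasurable)]
  refine lintegral_congr fun t => ?_
  have : (fun z : ℂ => (Ioi ‖z‖).indicator (fun t => ENNReal.ofReal t⁻¹) t)
      = (Metric.ball (0 : ℂ) t).indicator (fun _ => ENNReal.ofReal t⁻¹) := by
    ext z; simp [indicator]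
  rw [this, lintegral_indicator_const Metric.isOpen_ball.measurableSet, mul_comm]

lemma lintegral_setLIntegral_ball_div {g : ℂ → ENNReal} (hg : Measurable g) (r : ℝ) (hr : 1 ≤ r) :
    ∫⁻ t in Ioc 1 r, (∫⁻ z in Metric.ball 0 t, g z) * ENNReal.ofReal t⁻¹
      = ∫⁻ z, ENNReal.ofReal (logWeight r z) * g z := by
  have := lintegral_measure_ball_div (volume.withDensity g) r hr
  rw [lintegral_withDensity_eq_lintegral_mul _ hg
    (continuous_logWeight r).measurable.ennreal_ofReal] at this
  simp_rw [withDensity_apply g Metric.isOpen_ball.measurableSet] at this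
  rw [this]
  refine lintegral_congr fun z => by simp [mul_comm]

/-- The simple counting function as a weighted sum over the points where the value is taken. -/
lemma simpleCounting_eq_sum {f : ℂ → ℂ} {a : OnePoint ℂ} {r : ℝ} (hr : 1 ≤ r) {s : Finset ℂ}
    (hs : ∀ z, ‖z‖ ≤ r → TakesValueAt f a z → z ∈ s) (hs' : ∀ z ∈ s, TakesValueAt f a z) :
    simpleCounting f a r = ∑ z ∈ s, logWeight r z := by
  have hint : ∀ z : ℂ, IntegrableOn (fun t => (Ioi ‖z‖).indicator (fun t : ℝ => t⁻¹) t)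
      (Ioc 1 r) := by
    intro z
    refine IntegrableOn.indicator ?_ measurableSet_Ioi
    refine (intervalIntegral.intervalIntegrable_inv (f := fun x : ℝ => x)
      (fun x hx => ?_) continuousOn_id).1
    rw [uIcc_of_le hr] at hx
    exact (one_pos.trans_le hx.1).ne'
  have key : ∀ z : ℂ, ∫ t in Ioc 1 r, (Ioi ‖z‖).indicator (fun t : ℝ => t⁻¹) t
      = logWeight r z := by
    intro z
    rw [integral_eq_lintegral_of_nonneg_ae _ (hint z).aestronglyMeasurable]
    · rw [← ENNReal.toReal_ofReal (logWeight_nonneg r z), ← lintegral_Ioc_indicator_div r hr z]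
      congr 1
      refine lintegral_congr fun t => ?_
      by_cases h : t ∈ Ioi ‖z‖ <;> simp [h]
    · filter_upwards [ae_restrict_mem measurableSet_Ioc] with t ht
      refine indicator_apply_nonneg fun _ => ?_
      exact inv_nonneg.2 (by linarith [ht.1])
  simp_rw [← key]
  rw [← integral_finsetSum _ (fun z _ => hint z), simpleCounting,
    intervalIntegral.integral_of_le hr]
  refine setIntegral_congr_fun measurableSet_Ioc fun t ht => ?_
  have hset : {z : ℂ | z ∈ Metric.ball (0 : ℂ) t ∧ TakesValueAt f a z}
      = ↑(s.filter (fun z => ‖z‖ < t)) := by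
    ext z
    simp only [mem_ofPred_eq, mem_ball_zero_iff, Finset.coe_filter]
    constructor
    · rintro ⟨h1, h2⟩; exact ⟨hs z (h1.le.trans ht.2) h2, h1⟩
    · rintro ⟨h1, h2⟩; exact ⟨h2, hs' z h1⟩
  simp only [simpleCount]
  rw [hset, Set.ncard_coe_finset, Finset.card_filter]
  push_cast
  rw [Finset.sum_div]
  refine Finset.sum_congr rfl fun z _ => ?_
  by_cases h : ‖z‖ < t <;> simp [h]

/-! ### The area formula with multiplicities. -/

lemma HasDerivAt.hasFDerivAt_real {f : ℂ → ℂ} {f' z : ℂ} (h : HasDerivAt f f' z) :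
    HasFDerivAt f ((ContinuousLinearMap.toSpanSingleton ℂ f').restrictScalars ℝ) z :=
  h.hasFDerivAt.restrictScalars ℝ

lemma det_toSpanSingleton_restrictScalars (c : ℂ) :
    ((ContinuousLinearMap.toSpanSingleton ℂ c).restrictScalars ℝ).det = ‖c‖ ^ 2 := by
  simp [ContinuousLinearMap.det, LinearMap.det_restrictScalars, Algebra.norm_complex_apply,
    Complex.normSq_eq_norm_sq]

/-- An open set on which `f` is locally injective is a countable disjoint union of measurable
sets on which `f` is injective. -/
lemma exists_measurable_injOn_partition {f : ℂ → ℂ} {S : Set ℂ} (hS : IsOpen S)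
    (hf : ∀ z ∈ S, AnalyticAt ℂ f z ∧ deriv f z ≠ 0) :
    ∃ A : ℕ → Set ℂ, (∀ i, MeasurableSet (A i)) ∧ (∀ i, InjOn f (A i)) ∧
      Pairwise (Function.onFun Disjoint A) ∧ ⋃ i, A i = S := by
  have hloc : ∀ z ∈ S, ∃ U : Set ℂ, IsOpen U ∧ z ∈ U ∧ InjOn f U := by
    intro z hz
    have hd : HasStrictDerivAt f (deriv f z) z := (hf z hz).1.hasStrictDerivAt
    have hd' := hd.hasStrictFDerivAt_equiv (hf z hz).2
    exact ⟨_, (hd'.toOpenPartialHomeomorph f).open_source, hd'.mem_toOpenPartialHomeomorph_source,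
      (hd'.toOpenPartialHomeomorph f).injOn⟩
  choose! U hUo hUm hUi using hloc
  obtain ⟨t, htS, htc, hcov⟩ := TopologicalSpace.countable_cover_nhdsWithin
    (f := U) (s := S) fun z hz => mem_nhdsWithin_of_mem_nhds ((hUo z hz).mem_nhds (hUm z hz))
  rcases S.eq_empty_or_nonempty with rfl | hne
  · exact ⟨fun _ => ∅, by simp, by simp, by simp [Function.onFun, Pairwise], by simp⟩
  have htne : t.Nonempty := by
    obtain ⟨z, hz⟩ := hne
    obtain ⟨x, hx, -⟩ := mem_iUnion₂.1 (hcov hz)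
    exact ⟨x, hx⟩
  obtain ⟨g, rfl⟩ := htc.exists_eq_range htne
  refine ⟨disjointed fun i => U (g i) ∩ S, fun i => ?_, fun i => ?_, disjoint_disjointed _, ?_⟩
  · refine MeasurableSet.disjointed (fun j => ?_) i
    exact ((hUo _ (htS ⟨j, rfl⟩)).inter hS).measurableSet
  · exact (hUi _ (htS ⟨i, rfl⟩)).mono ((disjointed_subset _ i).trans inter_subset_left)
  · rw [iUnion_disjointed, ← iUnion_inter]
    refine inter_eq_right.2 ?_
    simpa using hcov

/-- Area formula with multiplicities for a holomorphic function without critical points, with the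
measurability of the weighted counting function. -/
lemma lintegral_mul_comp_mul_deriv_sq {f : ℂ → ℂ} {S : Set ℂ} (hS : IsOpen S)
    (hf : ∀ z ∈ S, AnalyticAt ℂ f z ∧ deriv f z ≠ 0) {h ρ : ℂ → ENNReal} (hh : Measurable h)
    (hρ : Measurable ρ) :
    (Measurable fun a => ∑' z, (S ∩ f ⁻¹' {a}).indicator h z) ∧
    ∫⁻ z in S, h z * ρ (f z) * ENNReal.ofReal (‖deriv f z‖ ^ 2)
      = ∫⁻ a, ρ a * ∑' z, (S ∩ f ⁻¹' {a}).indicator h z := by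
  obtain ⟨A, hAm, hAi, hAd, rfl⟩ := exists_measurable_injOn_partition hS hf
  have hder : ∀ i, ∀ z ∈ A i, HasFDerivWithinAt f
      ((ContinuousLinearMap.toSpanSingleton ℂ (deriv f z)).restrictScalars ℝ) (A i) z := fun i z hz =>
    (hf z (mem_iUnion.2 ⟨i, hz⟩)).1.differentiableAt.hasDerivAt.hasFDerivAt_real.hasFDerivWithinAt
  let k : ℕ → ℂ → ENNReal := fun i a => ∑' z, (A i ∩ f ⁻¹' {a}).indicator h z
  have hk1 : ∀ i, ∀ z ∈ A i, k i (f z) = h z := by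
    intro i z hz
    simp only [k]
    rw [tsum_eq_single z]
    · simp [hz]
    · intro w hw
      refine indicator_of_notMem (fun hw' => hw ?_) _
      exact hAi i hw'.1 hz hw'.2
  have hk0 : ∀ i, ∀ a ∉ f '' A i, k i a = 0 := by
    intro i a ha
    simp only [k, ENNReal.tsum_eq_zero]
    intro z
    exact indicator_of_notMem (fun hz => ha ⟨z, hz.1, hz.2⟩) _
  have hkm : ∀ i, Measurable (k i) := by
    intro i
    have hemb := measurableEmbedding_of_fderivWithin (hAm i) (hder i) (hAi i)
    -- Measurability in the target variable: on an injective piece the counting sum is `h`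
    -- transported along a measurable embedding and extended by zero.
    have : k i = Function.extend ((A i).domRestrict f) (fun z => h z) 0 := by
      ext a
      by_cases ha : a ∈ f '' A i
      · obtain ⟨z, hz, rfl⟩ := ha
        rw [hk1 i z hz]
        exact (hemb.injective.extend_apply (fun z : A i => h z) 0 ⟨z, hz⟩).symm
      · rw [hk0 i a ha, Function.extend_apply']
        · rfl
        · rintro ⟨z, rfl⟩
          exact ha ⟨z, z.2, rfl⟩
    rw [this]
    exact hemb.measurable_extend (hh.comp measurable_subtype_coe) measurable_const
  have hsum : ∀ a, ∑' z, ((⋃ i, A i) ∩ f ⁻¹' {a}).indicator h z = ∑' i, k i a := by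
    intro a
    simp only [k]
    rw [ENNReal.tsum_comm]
    refine tsum_congr fun z => ?_
    by_cases hz : ∃ i, z ∈ A i
    · obtain ⟨i, hi⟩ := hz
      rw [tsum_eq_single i]
      · have hz : z ∈ ⋃ i, A i := mem_iUnion.2 ⟨i, hi⟩
        by_cases hza : f z = a
        · rw [indicator_of_mem (show z ∈ (⋃ i, A i) ∩ f ⁻¹' {a} from ⟨hz, hza⟩),
            indicator_of_mem (show z ∈ A i ∩ f ⁻¹' {a} from ⟨hi, hza⟩)]
        · rw [indicator_of_notMem fun h => hza h.2, indicator_of_notMem fun h => hza h.2]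
      · intro j hj
        exact indicator_of_notMem
          (fun hz' => (hAd hj).le_bot ⟨hz'.1, hi⟩) _
    · have : z ∉ ⋃ i, A i := by simpa using hz
      push Not at hz
      simp [this, hz]
  simp_rw [hsum]
  refine ⟨Measurable.tsum hkm, ?_⟩
  rw [lintegral_iUnion hAm hAd]
  simp_rw [← ENNReal.tsum_mul_left]
  rw [lintegral_tsum fun i => (by exact (hρ.mul (hkm i)).aemeasurable)]
  refine tsum_congr fun i => ?_
  have hemb := measurableEmbedding_of_fderivWithin (hAm i) (hder i) (hAi i)
  have him : MeasurableSet (f '' A i) := by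
    have := hemb.measurableSet_range
    rwa [range_domRestrict] at this
  have h1 := lintegral_image_eq_lintegral_abs_det_fderiv_mul volume (hAm i) (hder i) (hAi i)
    (fun a => ρ a * k i a)
  have h2 : ∫⁻ a, ρ a * k i a = ∫⁻ a in f '' A i, ρ a * k i a := by
    rw [← lintegral_indicator him]
    refine lintegral_congr fun a => ?_
    by_cases ha : a ∈ f '' A i
    · rw [indicator_of_mem ha]
    · rw [indicator_of_notMem ha, hk0 i a ha, mul_zero]
  rw [h2, h1]
  refine setLIntegral_congr_fun (hAm i) fun z hz => ?_
  rw [hk1 i z hz, det_toSpanSingleton_restrictScalars, abs_of_nonneg (by positivity)]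
  ring

/-! ### Logarithmic counting functions as finite sums. -/

open Function.locallyFinsuppWithin in
lemma logCounting_eq_sum {D : Function.locallyFinsupp ℂ ℤ} {r : ℝ} (hr : 0 < r) {s : Finset ℂ}
    (hs : ∀ z, ‖z‖ ≤ r → D z ≠ 0 → z ∈ s) :
    logCounting D r = ∑ z ∈ s, if ‖z‖ ≤ r then (D z : ℝ) * (Real.log r - Real.log ‖z‖) else 0 := by
  have hD : (toClosedBall r D : ℂ → ℤ).HasFiniteSupport :=
    (toClosedBall r D).finiteSupport (isCompact_closedBall 0 |r|)
  -- Since `Real.log 0 = 0`, the origin contributes D 0 · log r to the uniform sum, which is exactly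
  -- the separate term at the origin in `logCounting`.
  have h := countingFunction_finsum_eq_finsum_add (c := 0) hr.ne' hD
  rw [toClosedBall_eval_within D (by simp)] at h
  have hz : ∀ z, ¬ ‖z‖ ≤ r → toClosedBall r D z = 0 := by
    intro z hz
    by_contra h
    have := toClosedBall_support_subset_closedBall D (r := r) h
    rw [mem_closedBall_zero_iff, abs_of_pos hr] at this
    exact hz this
  have hz' : ∀ z, ‖z‖ ≤ r → toClosedBall r D z = D z := fun z hz =>
    toClosedBall_eval_within D (by simpa [abs_of_pos hr] using hz)
  simp only [logCounting, AddMonoidHom.coe_mk, ZeroHom.coe_mk]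
  simp only [zero_sub, norm_neg] at h
  rw [← h, finsum_eq_sum_of_support_subset]
  · refine Finset.sum_congr rfl fun z _ => ?_
    split_ifs with h
    · rw [hz' z h]
    · rw [hz z h]; simp
  · intro z hzs
    have h1 : toClosedBall r D z ≠ 0 := fun h => hzs (by simp [h])
    have h2 : ‖z‖ ≤ r := by by_contra h; exact h1 (hz z h)
    exact hs z h2 (by rwa [hz' z h2] at h1)

lemma locallyFinsupp_finite_closedBall (D : Function.locallyFinsupp ℂ ℤ) (r : ℝ) :
    {z : ℂ | ‖z‖ ≤ r ∧ D z ≠ 0}.Finite := by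
  refine ((D.toClosedBall r).finiteSupport (isCompact_closedBall 0 |r|)).subset ?_
  rintro z ⟨h1, h2⟩
  rw [Function.mem_support, Function.locallyFinsuppWithin.toClosedBall_eval_within D]
  · exact h2
  · simpa using h1.trans (le_abs_self r)

open Function.locallyFinsuppWithin in
/-- Increments of the logarithmic counting function in terms of the weight. -/
lemma logCounting_sub_logCounting_one {D : Function.locallyFinsupp ℂ ℤ} {r : ℝ} (hr : 1 ≤ r)
    {s : Finset ℂ} (hs : ∀ z, ‖z‖ ≤ r → D z ≠ 0 → z ∈ s) :
    logCounting D r - logCounting D 1 = ∑ z ∈ s, (D z : ℝ) * logWeight r z := by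
  rw [logCounting_eq_sum (by linarith) hs,
    logCounting_eq_sum one_pos (s := s) fun z h => hs z (h.trans hr), ← Finset.sum_sub_distrib]
  refine Finset.sum_congr rfl fun z _ => ?_
  have hr0 : 0 < r := by linarith
  by_cases h1 : ‖z‖ ≤ 1
  · rw [if_pos (h1.trans hr), if_pos h1, logWeight_eq_log (by simp [h1, hr]), max_eq_left h1]
    simp; ring
  · push Not at h1
    rw [if_neg (not_le.2 h1)]
    split_ifs with h
    · rw [logWeight_eq_log (by simp [h, hr]), max_eq_right h1.le,
        Real.log_div hr0.ne' (by linarith)]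
      ring
    · rw [logWeight_eq_zero hr0.le ((not_le.1 h).le.trans (le_max_right _ _))]; simp

/-! ### Values on the sphere in terms of orders and divisors. -/

section values

variable {f : ℂ → ℂ} {z a : ℂ}

lemma MeromorphicAt.sub_const (hf : MeromorphicAt f z) (a : ℂ) :
    MeromorphicAt (fun w => f w - a) z := hf.fun_sub (MeromorphicAt.const a z)

lemma Meromorphic.sub_const (hf : Meromorphic f) (a : ℂ) :
    Meromorphic (fun w => f w - a) := fun z => (hf z).sub_const a

lemma takesValueAt_coe_iff_tendsto :
    TakesValueAt f (a : OnePoint ℂ) z ↔ Tendsto f (𝓝[≠] z) (𝓝 a) :=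
  (OnePoint.isOpenEmbedding_coe.isInducing.tendsto_nhds_iff).symm

lemma takesValueAt_coe_iff (hf : MeromorphicAt f z) :
    TakesValueAt f (a : OnePoint ℂ) z ↔ 0 < meromorphicOrderAt (fun w => f w - a) z := by
  rw [takesValueAt_coe_iff_tendsto, ← tendsto_zero_iff_meromorphicOrderAt_pos (hf.sub_const a)]
  exact (tendsto_sub_nhds_zero_iff).symm

lemma takesValueAt_infty_iff (hf : MeromorphicAt f z) :
    TakesValueAt f OnePoint.infty z ↔ meromorphicOrderAt f z < 0 := by
  rw [← tendsto_cobounded_iff_meromorphicOrderAt_neg hf, Metric.cobounded_eq_cocompact,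
    ← coclosedCompact_eq_cocompact, ← OnePoint.comap_coe_nhds_infty, tendsto_comap_iff]
  rfl

lemma takesValueAt_unique {a b : OnePoint ℂ} (ha : TakesValueAt f a z) (hb : TakesValueAt f b z) :
    a = b := tendsto_nhds_unique ha hb

/-- Identity theorem: an infinite order at one point propagates over the connected plane, and f
would then equal a on a codiscrete set. -/
lemma meromorphicOrderAt_sub_ne_top (hf : Meromorphic f) (hnc : MeromorphicNonconstant f) (a z : ℂ) :
    meromorphicOrderAt (fun w => f w - a) z ≠ ⊤ := by
  intro htop
  refine hnc a ?_
  have h : ∀ w, meromorphicOrderAt (fun w => f w - a) w = ⊤ := by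
    intro w
    by_contra hw
    exact (hf.sub_const a).meromorphicOn.meromorphicOrderAt_ne_top_of_isPreconnected
      isPreconnected_univ (mem_univ w) (mem_univ z) hw htop
  refine mem_codiscrete.2 fun x => ?_
  rw [disjoint_principal_right, compl_compl]
  filter_upwards [meromorphicOrderAt_eq_top_iff.1 (h x)] with w hw
  exact sub_eq_zero.1 hw

lemma meromorphicOrderAt_ne_top (hf : Meromorphic f) (hnc : MeromorphicNonconstant f) (z : ℂ) :
    meromorphicOrderAt f z ≠ ⊤ := by
  simpa using meromorphicOrderAt_sub_ne_top hf hnc 0 z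

lemma divisor_sub_apply (hf : Meromorphic f) (a z : ℂ) :
    MeromorphicOn.divisor (fun w => f w - a) univ z
      = (meromorphicOrderAt (fun w => f w - a) z).untop₀ :=
  MeromorphicOn.divisor_apply (hf.sub_const a).meromorphicOn (mem_univ z)

lemma takesValueAt_coe_iff_divisor (hf : Meromorphic f) (hnc : MeromorphicNonconstant f) :
    TakesValueAt f (a : OnePoint ℂ) z
      ↔ 0 < MeromorphicOn.divisor (fun w => f w - a) univ z := by
  rw [takesValueAt_coe_iff (hf z), divisor_sub_apply hf]
  lift meromorphicOrderAt (fun w => f w - a) z to ℤ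
    using meromorphicOrderAt_sub_ne_top hf hnc a z with n
  simp

lemma takesValueAt_infty_iff_divisor (hf : Meromorphic f) (hnc : MeromorphicNonconstant f) :
    TakesValueAt f OnePoint.infty z ↔ MeromorphicOn.divisor f univ z < 0 := by
  rw [takesValueAt_infty_iff (hf z), MeromorphicOn.divisor_apply hf.meromorphicOn (mem_univ z)]
  lift meromorphicOrderAt f z to ℤ using meromorphicOrderAt_ne_top hf hnc z with n
  simp

lemma finite_takesValueAt (hf : Meromorphic f) (hnc : MeromorphicNonconstant f)
    (a : OnePoint ℂ) (r : ℝ) : {z : ℂ | ‖z‖ ≤ r ∧ TakesValueAt f a z}.Finite := by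
  induction a using OnePoint.rec with
  | infty =>
    refine (locallyFinsupp_finite_closedBall (MeromorphicOn.divisor f univ) r).subset ?_
    rintro z ⟨h1, h2⟩
    exact ⟨h1, ((takesValueAt_infty_iff_divisor hf hnc).1 h2).ne⟩
  | coe a =>
    refine (locallyFinsupp_finite_closedBall (MeromorphicOn.divisor (fun w => f w - a) univ) r).subset ?_
    rintro z ⟨h1, h2⟩
    exact ⟨h1, ((takesValueAt_coe_iff_divisor hf hnc).1 h2).ne'⟩

open Classical in
/-- A divisor bounded below by a multiple of the simple points of some values is counted below by
the same multiple of the simple counting functions. -/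
lemma mul_sum_simpleCounting_le (hf : Meromorphic f) (hnc : MeromorphicNonconstant f)
    {E : Function.locallyFinsupp ℂ ℤ} {B : Finset (OnePoint ℂ)}
    {k : ℤ}
    (hE : ∀ z, k * (∑ a ∈ B, if TakesValueAt f a z then (1 : ℤ) else 0) ≤ E z) {r : ℝ} (hr : 1 ≤ r) :
    k * ∑ a ∈ B, simpleCounting f a r
      ≤ Function.locallyFinsuppWithin.logCounting E r
        - Function.locallyFinsuppWithin.logCounting E 1 := by
  have hfin : ({z : ℂ | ‖z‖ ≤ r ∧ E z ≠ 0} ∪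
      ⋃ a ∈ B, {z : ℂ | ‖z‖ ≤ r ∧ TakesValueAt f a z}).Finite :=
    (locallyFinsupp_finite_closedBall E r).union (B.finite_toSet.biUnion fun a _ => finite_takesValueAt hf hnc a r)
  set s := hfin.toFinset with hs
  have h1 : ∀ a ∈ B, simpleCounting f a r
      = ∑ z ∈ s, (if TakesValueAt f a z then (1 : ℝ) else 0) * logWeight r z := by
    intro a ha
    rw [simpleCounting_eq_sum hr (s := s.filter (TakesValueAt f a)), Finset.sum_filter]
    · refine Finset.sum_congr rfl fun z _ => by simp
    · intro z hz hz'
      refine Finset.mem_filter.2 ⟨hfin.mem_toFinset.2 (Or.inr ?_), hz'⟩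
      exact mem_iUnion₂.2 ⟨a, ha, hz, hz'⟩
    · intro z hz
      exact (Finset.mem_filter.1 hz).2
  rw [logCounting_sub_logCounting_one hr (s := s)
    fun z h h' => hfin.mem_toFinset.2 (Or.inl ⟨h, h'⟩), Finset.sum_congr rfl h1, Finset.sum_comm,
    Finset.mul_sum]
  refine Finset.sum_le_sum fun z _ => ?_
  rw [← Finset.sum_mul, ← mul_assoc]
  refine mul_le_mul_of_nonneg_right ?_ (logWeight_nonneg r z)
  exact_mod_cast hE z

end values

/-! ### The divisor inequality behind truncation. -/

section
variable {f : ℂ → ℂ}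

lemma meromorphicOrderAt_sub_of_neg (a : ℂ) {z : ℂ}
    (h : meromorphicOrderAt f z < 0) :
    meromorphicOrderAt (fun w => f w - a) z = meromorphicOrderAt f z := by
  have h1 : (fun w => f w - a) = f + fun _ => -a := by ext w; simp [sub_eq_add_neg]
  rw [h1]
  refine meromorphicOrderAt_add_eq_left_of_lt (MeromorphicAt.const _ z) (h.trans_le ?_)
  exact (analyticAt_const).meromorphicOrderAt_nonneg

lemma deriv_sub_const' (a : ℂ) : deriv (fun w => f w - a) = deriv f := by
  ext w; simp

lemma meromorphicOrderAt_deriv_eq (hf : Meromorphic f) (hnc : MeromorphicNonconstant f)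
    (a z : ℂ) (h : meromorphicOrderAt (fun w => f w - a) z ≠ 0) :
    meromorphicOrderAt (deriv f) z
      = (((meromorphicOrderAt (fun w => f w - a) z).untop₀ - 1 : ℤ) : WithTop ℤ) := by
  have hne := meromorphicOrderAt_sub_ne_top hf hnc a z
  rw [← deriv_sub_const' a]
  refine meromorphicOrderAt_deriv_eq_sub_one ?_ (WithTop.coe_untop₀_of_ne_top hne).symm
  rw [Int.cast_ne_zero]
  intro h0
  apply h
  rw [← WithTop.coe_untop₀_of_ne_top hne, h0]; rfl

lemma meromorphic_dichotomy (hf : Meromorphic f) (z : ℂ) :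
    meromorphicOrderAt f z < 0 ∨ ∃ c : ℂ, TakesValueAt f (c : OnePoint ℂ) z := by
  rcases lt_or_ge (meromorphicOrderAt f z) 0 with h | h
  · exact Or.inl h
  · obtain ⟨c, hc⟩ := tendsto_nhds_of_meromorphicOrderAt_nonneg (hf z) h
    exact Or.inr ⟨c, takesValueAt_coe_iff_tendsto.2 hc⟩

lemma meromorphicOrderAt_deriv_ne_top (hf : Meromorphic f) (hnc : MeromorphicNonconstant f)
    (z : ℂ) : meromorphicOrderAt (deriv f) z ≠ ⊤ := by
  rcases meromorphic_dichotomy hf z with h | ⟨c, hc⟩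
  · rw [meromorphicOrderAt_deriv_eq hf hnc 0 z (by simpa using h.ne)]
    exact WithTop.coe_ne_top
  · rw [meromorphicOrderAt_deriv_eq hf hnc c z ((takesValueAt_coe_iff (hf z)).1 hc).ne']
    exact WithTop.coe_ne_top

lemma divisor_sub_eq_zero (hf : Meromorphic f) {b c z : ℂ}
    (hc : TakesValueAt f (c : OnePoint ℂ) z) (hbc : c ≠ b) :
    MeromorphicOn.divisor (fun w => f w - b) univ z = 0 := by
  rw [divisor_sub_apply hf]
  have : meromorphicOrderAt (fun w => f w - b) z = 0 := by
    rw [← tendsto_ne_zero_iff_meromorphicOrderAt_eq_zero ((hf z).sub_const b)]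
    exact ⟨c - b, sub_ne_zero.2 hbc, (takesValueAt_coe_iff_tendsto.1 hc).sub_const b⟩
  simp [this]

/-- The combination of divisors occurring in the second main theorem. -/
noncomputable def ramificationDivisor (f : ℂ → ℂ) (F : Finset ℂ) : Function.locallyFinsupp ℂ ℤ :=
  MeromorphicOn.divisor (deriv f) univ - ∑ b ∈ F, MeromorphicOn.divisor (fun w => f w - b) univ
    - (F.card - 1) • (MeromorphicOn.divisor f univ)⁻

-- At a pole of order m the value is (-m - 1) + |F| m - (|F| - 1) m = -1. At a point where f takes a
-- finite value c with multiplicity m, f' has order m - 1, and subtracting m when c ∈ F leaves -1;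
-- when c ∉ F the value m - 1 is nonnegative. The multiplicities thus cancel, which is why the
-- counting functions come out truncated.
open Classical in
lemma neg_sum_le_ramificationDivisor (hf : Meromorphic f) (hnc : MeromorphicNonconstant f)
    {F : Finset ℂ} (hF : F.Nonempty) (z : ℂ) :
    -1 * (∑ a ∈ insert OnePoint.infty (F.map ⟨_, OnePoint.coe_injective⟩),
        if TakesValueAt f a z then (1 : ℤ) else 0) ≤ ramificationDivisor f F z := by
  rw [Finset.sum_insert (by simp), Finset.sum_map]
  simp only [Function.Embedding.coeFn_mk]
  have hd : ramificationDivisor f F z = MeromorphicOn.divisor (deriv f) univ z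
      - ∑ b ∈ F, MeromorphicOn.divisor (fun w => f w - b) univ z
      - (F.card - 1 : ℤ) * max (-MeromorphicOn.divisor f univ z) 0 := by
    have : ((F.card - 1 : ℕ) : ℤ) = F.card - 1 := by
      rw [Nat.cast_sub hF.card_pos]; simp
    simp [ramificationDivisor, this, negPart_def]
  have hd' : MeromorphicOn.divisor (deriv f) univ z = (meromorphicOrderAt (deriv f) z).untop₀ :=
    MeromorphicOn.divisor_apply hf.deriv.meromorphicOn (mem_univ z)
  have hd0 : MeromorphicOn.divisor f univ z = (meromorphicOrderAt f z).untop₀ :=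
    MeromorphicOn.divisor_apply hf.meromorphicOn (mem_univ z)
  rcases meromorphic_dichotomy hf z with h | ⟨c, hc⟩
  · have h1 : ∀ b ∈ F, MeromorphicOn.divisor (fun w => f w - b) univ z
        = (meromorphicOrderAt f z).untop₀ := fun b _ => by
      rw [divisor_sub_apply hf, meromorphicOrderAt_sub_of_neg b h]
    have h2 := meromorphicOrderAt_deriv_eq hf hnc 0 z (by simpa using h.ne)
    simp only [sub_zero] at h2
    have hinf : TakesValueAt f OnePoint.infty z := (takesValueAt_infty_iff (hf z)).2 h
    have h3 : (meromorphicOrderAt f z).untop₀ < 0 := by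
      rw [← hd0]; exact (takesValueAt_infty_iff_divisor hf hnc).1 hinf
    have h4 : ∑ b ∈ F, (if TakesValueAt f (b : OnePoint ℂ) z then (1 : ℤ) else 0) = 0 := by
      refine Finset.sum_eq_zero fun b _ => if_neg fun hb => ?_
      exact OnePoint.coe_ne_infty b (takesValueAt_unique hb hinf)
    rw [hd, hd', h2, Finset.sum_congr rfl h1, hd0, h4, if_pos hinf, max_eq_left (by omega)]
    simp only [WithTop.untop₀_coe, Finset.sum_const, nsmul_eq_mul]
    linarith
  · have hninf : ¬ TakesValueAt f OnePoint.infty z := fun h =>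
      OnePoint.coe_ne_infty c (takesValueAt_unique hc h)
    have hpos := (takesValueAt_coe_iff (hf z)).1 hc
    have h2 := meromorphicOrderAt_deriv_eq hf hnc c z hpos.ne'
    have h3 : 0 < MeromorphicOn.divisor (fun w => f w - c) univ z :=
      (takesValueAt_coe_iff_divisor hf hnc).1 hc
    have h4 : 0 ≤ MeromorphicOn.divisor f univ z := by
      by_contra h
      exact hninf ((takesValueAt_infty_iff_divisor hf hnc).2 (not_le.1 h))
    have h5 : ∀ b : ℂ, (if TakesValueAt f (b : OnePoint ℂ) z then (1 : ℤ) else 0)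
        = if c = b then 1 else 0 := by
      intro b
      congr 1
      rw [eq_iff_iff]
      exact ⟨fun hb => OnePoint.coe_injective (takesValueAt_unique hc hb), fun hb => hb ▸ hc⟩
    have h6 : ∀ b ∈ F, MeromorphicOn.divisor (fun w => f w - b) univ z
        = if c = b then MeromorphicOn.divisor (fun w => f w - c) univ z else 0 := by
      intro b _
      split_ifs with hb
      · rw [hb]
      · exact divisor_sub_eq_zero hf hc hb
    rw [hd, hd', h2, Finset.sum_congr rfl h6, if_neg hninf, max_eq_right (by omega)]
    simp_rw [h5]
    rw [Finset.sum_ite_eq, Finset.sum_ite_eq, ← divisor_sub_apply hf]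
    simp only [WithTop.untop₀_coe]
    split_ifs <;> omega

/-! ### The first main theorem with explicit constants. -/

/-- The trailing coefficient of `f - a` at the origin depends on `a` only through `a - b`, where
`b` is the limit value at the origin. -/
lemma exists_abs_log_trailingCoeff_le (hf : Meromorphic f) :
    ∃ b : ℂ, ∃ K : ℝ, 0 ≤ K ∧ ∀ a, a ≠ b →
      |Real.log ‖meromorphicTrailingCoeffAt (fun w => f w - a) 0‖|
        ≤ |Real.log ‖a - b‖| + K := by
  rcases meromorphic_dichotomy hf 0 with h | ⟨c, hc⟩
  -- At a pole, subtracting a constant does not change the leading coefficient, so the choice of b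
  -- is immaterial and 0 serves.
  · refine ⟨0, |Real.log ‖meromorphicTrailingCoeffAt f 0‖|, abs_nonneg _, fun a _ => ?_⟩
    rw [MeromorphicAt.meromorphicTrailingCoeffAt_fun_sub_eq_left_of_lt (MeromorphicAt.const a 0)
      (h.trans_le analyticAt_const.meromorphicOrderAt_nonneg)]
    linarith [abs_nonneg (Real.log ‖a - 0‖)]
  · refine ⟨c, 0, le_rfl, fun a ha => ?_⟩
    have hca : c - a ≠ 0 := sub_ne_zero.2 ha.symm
    have h1 : Tendsto (fun w => f w - a) (𝓝[≠] 0) (𝓝 (c - a)) :=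
      (takesValueAt_coe_iff_tendsto.1 hc).sub_const a
    have h2 : meromorphicOrderAt (fun w => f w - a) 0 = 0 :=
      (tendsto_ne_zero_iff_meromorphicOrderAt_eq_zero ((hf 0).sub_const a)).1 ⟨_, hca, h1⟩
    have h3 := ((hf 0).sub_const a).tendsto_nhds_meromorphicTrailingCoeffAt
    simp only [h2, WithTop.untop₀_zero, neg_zero, zpow_zero] at h3
    have h4 : meromorphicTrailingCoeffAt (fun w => f w - a) 0 = c - a := by
      refine tendsto_nhds_unique (h3.congr fun w => ?_) h1
      simp
    rw [h4, add_zero, norm_sub_rev]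

open ValueDistribution in
/-- First main theorem with explicit dependence on the value. -/
lemma abs_logCounting_add_proximity_sub_characteristic_le (hf : Meromorphic f) (a : ℂ) {r : ℝ}
    (hr : r ≠ 0) :
    |logCounting f a r + proximity f a r - characteristic f ⊤ r|
      ≤ Real.posLog ‖a‖ + Real.log 2
        + |Real.log ‖meromorphicTrailingCoeffAt (fun w => f w - a) 0‖| := by
  have h1 := abs_characteristic_sub_characteristic_shift_le (r := r) (a₀ := a) hf
  have h2 := characteristic_sub_characteristic_inv_of_ne_zero (hf.sub_const a) hr
  have h3 : characteristic (fun w => f w - a)⁻¹ ⊤ r = logCounting f a r + proximity f a r := by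
    simp only [characteristic, Pi.add_apply]
    rw [proximity_inv, logCounting_inv, logCounting_coe_eq_logCounting_sub_const_zero,
      proximity_coe_eq_proximity_sub_const_zero, add_comm]
    rfl
  rw [h3] at h2
  have h4 : logCounting f a r + proximity f a r - characteristic f ⊤ r
      = -(characteristic f ⊤ r - characteristic (fun w => f w - a) ⊤ r)
        - Real.log ‖meromorphicTrailingCoeffAt (fun w => f w - a) 0‖ := by
    linarith
  rw [h4]
  refine (abs_sub _ _).trans ?_
  rw [abs_neg]
  exact add_le_add h1 le_rfl

-- N̄ ≤ N ≤ T + O(1). This is what permits auxiliary targets to be dropped later.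
open ValueDistribution in
lemma exists_simpleCounting_le (hf : Meromorphic f) (hnc : MeromorphicNonconstant f)
    (a : OnePoint ℂ) : ∃ K : ℝ, ∀ r, 1 ≤ r → simpleCounting f a r ≤ characteristic f ⊤ r + K := by
  classical
  induction a using OnePoint.rec with
  | infty =>
    refine ⟨0, fun r hr => ?_⟩
    have h := mul_sum_simpleCounting_le hf hnc (k := 1) (E := (MeromorphicOn.divisor f univ)⁻)
      (B := {OnePoint.infty}) (fun z => ?_) hr
    · simp only [Finset.sum_singleton, Int.cast_one, one_mul, ← logCounting_top] at h
      have h1 : 0 ≤ logCounting f ⊤ 1 := logCounting_nonneg le_rfl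
      have h2 := proximity_nonneg (f := f) (a := ⊤) r
      simp only [Pi.zero_apply] at h2
      simp only [characteristic, Pi.add_apply]
      linarith
    · simp only [Finset.sum_singleton, takesValueAt_infty_iff_divisor hf hnc, negPart_def]
      simp only [Function.locallyFinsuppWithin.max_apply, Function.locallyFinsuppWithin.coe_neg,
        Pi.neg_apply, Function.locallyFinsuppWithin.coe_zero, Pi.zero_apply]
      split_ifs <;> omega
  | coe a =>
    refine ⟨Real.posLog ‖a‖ + Real.log 2
        + |Real.log ‖meromorphicTrailingCoeffAt (fun w => f w - a) 0‖|, fun r hr => ?_⟩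
    have h0 := (abs_le.1 (abs_logCounting_add_proximity_sub_characteristic_le hf a
      (by linarith : r ≠ 0))).2
    have h := mul_sum_simpleCounting_le hf hnc (k := 1)
      (E := (MeromorphicOn.divisor (fun w => f w - a) univ)⁺)
      (B := {(a : OnePoint ℂ)}) (fun z => ?_) hr
    · simp only [Finset.sum_singleton, Int.cast_one, one_mul, ← logCounting_coe] at h
      have h1 : 0 ≤ logCounting f a 1 := logCounting_nonneg le_rfl
      have h2 := proximity_nonneg (f := f) (a := a) r
      simp only [Pi.zero_apply] at h2
      linarith
    · simp only [Finset.sum_singleton, takesValueAt_coe_iff_divisor hf hnc, posPart_def]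
      simp only [Function.locallyFinsuppWithin.max_apply, Function.locallyFinsuppWithin.coe_zero,
        Pi.zero_apply]
      split_ifs <;> omega

lemma logWeight_le_simpleCounting (hf : Meromorphic f) (hnc : MeromorphicNonconstant f)
    {a : OnePoint ℂ} {z : ℂ} (h : TakesValueAt f a z) {r : ℝ} (hr : 1 ≤ r) :
    logWeight r z ≤ simpleCounting f a r := by
  classical
  have hfin := (finite_takesValueAt hf hnc a r)
  rw [simpleCounting_eq_sum hr (s := hfin.toFinset) (fun z h h' => hfin.mem_toFinset.2 ⟨h, h'⟩)
    fun z hz => (hfin.mem_toFinset.1 hz).2]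
  by_cases hz : ‖z‖ ≤ r
  · exact Finset.single_le_sum (fun w _ => logWeight_nonneg r w) (hfin.mem_toFinset.2 ⟨hz, h⟩)
  · rw [logWeight_eq_zero (by linarith) ((not_le.1 hz).le.trans (le_max_right _ _))]
    exact Finset.sum_nonneg fun w _ => logWeight_nonneg r w

lemma simpleCounting_nonneg (hf : Meromorphic f) (hnc : MeromorphicNonconstant f)
    (a : OnePoint ℂ) {r : ℝ} (hr : 1 ≤ r) : 0 ≤ simpleCounting f a r := by
  have hfin := (finite_takesValueAt hf hnc a r)
  rw [simpleCounting_eq_sum hr (s := hfin.toFinset) (fun z h h' => hfin.mem_toFinset.2 ⟨h, h'⟩)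
    fun z hz => (hfin.mem_toFinset.1 hz).2]
  exact Finset.sum_nonneg fun w _ => logWeight_nonneg r w

/-- The value of f at the origin, possibly ∞, is taken there, so its simple counting function is at
least log r; the first main theorem bounds that function by T + O(1). -/
lemma tendsto_characteristic_atTop (hf : Meromorphic f) (hnc : MeromorphicNonconstant f) :
    Tendsto (ValueDistribution.characteristic f ⊤) atTop atTop := by
  obtain ⟨a, ha⟩ : ∃ a : OnePoint ℂ, TakesValueAt f a 0 := by
    rcases meromorphic_dichotomy hf 0 with h | ⟨c, hc⟩
    · exact ⟨_, (takesValueAt_infty_iff (hf 0)).2 h⟩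
    · exact ⟨_, hc⟩
  obtain ⟨K, hK⟩ := exists_simpleCounting_le hf hnc a
  refine tendsto_atTop_mono' _ ?_ (tendsto_atTop_add_const_right _ (-K) Real.tendsto_log_atTop)
  filter_upwards [eventually_ge_atTop 1] with r hr
  have h1 := logWeight_le_simpleCounting hf hnc ha hr
  rw [logWeight_eq_log (by simpa using hr)] at h1
  have h2 := hK r hr
  simp at h1
  linarith

end

/-! ### Borel's growth lemma and circle means. -/

/-- A lower part of a half-line has mass bounded by the masses of its initial intervals. -/
lemma measure_le_of_forall_Ioc_le {ν : Measure ℝ} [NullSingletonClass ν] {a : ℝ} {I : Set ℝ} {c : ENNReal}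
    (hI : ∀ x ∈ I, a < x) (hlow : ∀ x ∈ I, ∀ y, a < y → y ≤ x → y ∈ I)
    (hc : ∀ x ∈ I, ν (Ioc a x) ≤ c) : ν I ≤ c := by
  -- Intervals with rational right end in I exhaust I except perhaps for its greatest element, which
  -- is a null set.
  let Q : Set ℚ := {q | (q : ℝ) ∈ I}
  have hsub : I ⊆ (⋃ q ∈ Q, Ioc a (q : ℝ)) ∪ {x | IsGreatest I x} := by
    intro x hx
    by_cases hg : IsGreatest I x
    · exact Or.inr hg
    · left
      have : ∃ y ∈ I, x < y := by
        by_contra hcon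
        push Not at hcon
        exact hg ⟨hx, hcon⟩
      obtain ⟨y, hy, hxy⟩ := this
      obtain ⟨q, hxq, hqy⟩ := exists_rat_btwn hxy
      refine mem_iUnion₂.2 ⟨q, hlow y hy q ((hI x hx).trans hxq) hqy.le, hI x hx, hxq.le⟩
  have hgr : {x | IsGreatest I x}.Subsingleton := fun x hx y hy => hx.unique hy
  refine (measure_mono hsub).trans ((measure_union_le _ _).trans ?_)
  rw [hgr.measure_zero, add_zero, measure_biUnion_eq_iSup (Set.to_countable Q)]
  · exact iSup₂_le fun q hq => hc q hq
  · intro p hp q hq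
    rcases le_total p q with h | h
    · exact ⟨q, hq, Ioc_subset_Ioc_right (by exact_mod_cast h), le_rfl⟩
    · exact ⟨p, hp, le_rfl, Ioc_subset_Ioc_right (by exact_mod_cast h)⟩

/-- Borel's growth lemma: a density is bounded by a power `> 1` of its primitive outside a set of
finite measure. -/
lemma volume_primitive_rpow_lt_lt_top {φ : ℝ → ENNReal} (hφ : Measurable φ) (a : ℝ)
    (hfin : ∀ r, ∫⁻ t in Ioc a r, φ t < ⊤) {ε : ℝ} (hε : 0 < ε) :
    volume {r | a < r ∧ (1 + ∫⁻ t in Ioc a r, φ t) ^ (1 + ε) < φ r} < ⊤ := by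
  set F : ℝ → ENNReal := fun r => 1 + ∫⁻ t in Ioc a r, φ t with hF
  have hFmono : ∀ x y, x ≤ y → F x ≤ F y := fun x y hxy =>
    add_le_add le_rfl (lintegral_mono_set (Ioc_subset_Ioc_right hxy))
  have hF1 : ∀ r, 1 ≤ F r := fun r => le_self_add
  have hFtop : ∀ r, F r < ⊤ := fun r => ENNReal.add_lt_top.2 ⟨ENNReal.one_lt_top, hfin r⟩
  let I : ℕ → Set ℝ := fun k => {r | a < r ∧ F r < 2 ^ (k + 1)}
  have hIord : ∀ k, OrdConnected (I k) := fun k => ⟨fun x hx y hy z hz =>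
    ⟨hx.1.trans_le hz.1, (hFmono _ _ hz.2).trans_lt hy.2⟩⟩
  have hIm : ∀ k, MeasurableSet (I k) := fun k => (hIord k).measurableSet
  have hImass : ∀ k, ∫⁻ t in I k, φ t ≤ 2 ^ (k + 1) := by
    intro k
    rw [← withDensity_apply φ (hIm k)]
    refine measure_le_of_forall_Ioc_le (a := a) (fun x hx => hx.1)
      (fun x hx y hay hyx => ⟨hay, (hFmono _ _ hyx).trans_lt hx.2⟩) fun x hx => ?_
    rw [withDensity_apply φ measurableSet_Ioc]
    exact le_add_self.trans hx.2.le
  -- Dyadic decomposition by the size of the primitive: where 2^k ≤ F < 2^(k+1), the bad set lies in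
  -- φ ≥ 2^(k(1+ε)). Markov's inequality gives it measure at most 2 · 2^(-εk), a summable geometric
  -- sequence.
  let E : ℕ → Set ℝ := fun k => I k ∩ {r | ENNReal.ofReal ((2 : ℝ) ^ (k * (1 + ε))) ≤ φ r}
  have hcov : {r | a < r ∧ F r ^ (1 + ε) < φ r} ⊆ ⋃ k, E k := by
    rintro r ⟨har, hr⟩
    have h1 : 1 ≤ (F r).toReal := by
      simpa using ENNReal.toReal_mono (hFtop r).ne (hF1 r)
    obtain ⟨k, hk1, hk2⟩ := exists_nat_pow_near h1 (one_lt_two)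
    refine mem_iUnion.2 ⟨k, ⟨har, ?_⟩, ?_⟩
    · rw [← ENNReal.ofReal_toReal (hFtop r).ne]
      refine (ENNReal.ofReal_lt_ofReal_iff (by positivity)).2 hk2 |>.trans_le ?_
      rw [ENNReal.ofReal_pow (by norm_num)]; simp
    · refine le_trans ?_ hr.le
      rw [← ENNReal.ofReal_toReal (hFtop r).ne,
        ENNReal.ofReal_rpow_of_nonneg (by positivity) (by positivity)]
      refine ENNReal.ofReal_le_ofReal ?_
      rw [Real.rpow_mul (by norm_num), Real.rpow_natCast]
      exact Real.rpow_le_rpow (by positivity) hk1 (by positivity)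
  have hEk : ∀ k, volume (E k) ≤ 2 * ENNReal.ofReal ((2 : ℝ) ^ (-ε)) ^ k := by
    intro k
    have h1 := mul_meas_ge_le_lintegral (μ := volume.restrict (I k)) hφ
      (ENNReal.ofReal ((2 : ℝ) ^ (k * (1 + ε))))
    rw [Measure.restrict_apply (measurableSet_le measurable_const hφ), inter_comm] at h1
    have h2 := h1.trans (hImass k)
    have hpos : (0 : ℝ) < (2 : ℝ) ^ (k * (1 + ε)) := by positivity
    have h3 : volume (E k) ≤ 2 ^ (k + 1) / ENNReal.ofReal ((2 : ℝ) ^ (k * (1 + ε))) := by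
      rw [ENNReal.le_div_iff_mul_le (Or.inl (by simpa using hpos)) (Or.inl ENNReal.ofReal_ne_top),
        mul_comm]
      exact h2
    refine h3.trans (le_of_eq ?_)
    have h4 : (2 : ENNReal) ^ (k + 1) = ENNReal.ofReal ((2 : ℝ) ^ (k + 1)) := by
      rw [ENNReal.ofReal_pow (by norm_num)]; simp
    rw [h4, ← ENNReal.ofReal_div_of_pos hpos, ← ENNReal.ofReal_pow (by positivity)]
    have h5 : (2 : ENNReal) = ENNReal.ofReal 2 := by simp
    rw [h5, ← ENNReal.ofReal_mul (by norm_num)]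
    congr 1
    rw [← Real.rpow_natCast, ← Real.rpow_natCast, ← Real.rpow_sub (by norm_num),
      ← Real.rpow_mul (by norm_num)]
    nth_rw 2 [← Real.rpow_one 2]
    rw [← Real.rpow_add (by norm_num)]
    congr 1
    push_cast
    ring
  refine (measure_mono hcov).trans_lt ((measure_iUnion_le _).trans_lt ?_)
  refine (ENNReal.tsum_le_tsum hEk).trans_lt ?_
  rw [ENNReal.tsum_mul_left, ENNReal.tsum_geometric]
  refine ENNReal.mul_lt_top (by simp) (ENNReal.inv_lt_top.2 ?_)
  rw [tsub_pos_iff_lt]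
  rw [← ENNReal.ofReal_one, ENNReal.ofReal_lt_ofReal_iff one_pos]
  exact Real.rpow_lt_one_of_one_lt_of_neg (by norm_num) (by linarith)

lemma lintegral_polar (g : ℂ → ENNReal) (hg : Measurable g) :
    ∫⁻ z, g z = ∫⁻ s in Ioi (0 : ℝ), ENNReal.ofReal s *
      ∫⁻ θ in Ioo (-Real.pi) Real.pi, g (circleMap 0 s θ) := by
  rw [← Complex.lintegral_comp_polarCoord_symm]
  have hcm : Measurable fun p : ℝ × ℝ => circleMap 0 p.1 p.2 := by
    unfold circleMap; fun_prop
  have : ∀ p : ℝ × ℝ, Complex.polarCoord.symm p = circleMap 0 p.1 p.2 := by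
    intro p
    rw [Complex.polarCoord_symm_apply, circleMap_zero, Complex.exp_mul_I]
    simp
  simp_rw [this, smul_eq_mul]
  rw [polarCoord_target, Measure.volume_eq_prod, ← Measure.prod_restrict, lintegral_prod]
  · refine lintegral_congr fun s => ?_
    simp only
    rw [lintegral_const_mul]
    exact hg.comp (hcm.comp measurable_prodMk_left)
  · exact (((by fun_prop : Measurable fun p : ℝ × ℝ => ENNReal.ofReal p.1)).mul
      (hg.comp hcm)).aemeasurable

/-- Exhibits the disc integral as a primitive in the radius, so that the growth lemma can be applied
to it. -/
lemma setLIntegral_ball_polar {g : ℂ → ENNReal} (hg : Measurable g) (t : ℝ) :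
    ∫⁻ z in Metric.ball 0 t, g z = ∫⁻ s in Ioc 0 t, ENNReal.ofReal s *
      ∫⁻ θ in Ioo (-Real.pi) Real.pi, g (circleMap 0 s θ) := by
  rw [← lintegral_indicator Metric.isOpen_ball.measurableSet,
    lintegral_polar _ (hg.indicator Metric.isOpen_ball.measurableSet),
    ← restrict_Ioo_eq_restrict_Ioc, ← lintegral_indicator measurableSet_Ioi,
    ← lintegral_indicator measurableSet_Ioo]
  refine lintegral_congr fun s => ?_
  by_cases hs : 0 < s
  · by_cases hst : s < t
    · rw [indicator_of_mem (mem_Ioi.2 hs), indicator_of_mem (mem_Ioo.2 ⟨hs, hst⟩)]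
      congr 1
      refine lintegral_congr fun θ => indicator_of_mem ?_ _
      simpa [abs_of_pos hs] using hst
    · rw [indicator_of_mem (mem_Ioi.2 hs), indicator_of_notMem (fun h => hst h.2)]
      have : ∀ θ, (Metric.ball 0 t).indicator g (circleMap 0 s θ) = 0 := fun θ =>
        indicator_of_notMem (by simpa [abs_of_pos hs] using hst) _
      simp [this]
  · rw [indicator_of_notMem (by simpa using hs), indicator_of_notMem (fun h => hs h.1)]

lemma measurable_setLIntegral_ball (g : ℂ → ENNReal) :
    Measurable fun t : ℝ => ∫⁻ z in Metric.ball 0 t, g z := by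
  have hmono : Monotone fun t : ℝ => ∫⁻ z in Metric.ball 0 t, g z := fun x y hxy =>
    lintegral_mono_set (Metric.ball_subset_ball hxy)
  exact hmono.measurable

lemma measurable_lintegral_circle {g : ℂ → ENNReal} (hg : Measurable g) :
    Measurable fun s : ℝ => ∫⁻ θ in Ioo (-Real.pi) Real.pi, g (circleMap 0 s θ) := by
  have hcm : Measurable fun p : ℝ × ℝ => circleMap 0 p.1 p.2 := by
    unfold circleMap; fun_prop
  exact (hg.comp hcm).lintegral_prod_right'

/-- Disc masses increase with t: an infinite one would make the logarithmic average infinite over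
the next unit interval. -/
lemma setLIntegral_ball_lt_top {ψ : ℂ → ENNReal}
    (hfin : ∀ r, ∫⁻ t in Ioc 1 r, (∫⁻ z in Metric.ball 0 t, ψ z) * ENNReal.ofReal t⁻¹ < ⊤) (t : ℝ) :
    ∫⁻ z in Metric.ball 0 t, ψ z < ⊤ := by
  set A : ℝ → ENNReal := fun t => ∫⁻ z in Metric.ball 0 t, ψ z with hA
  have hAmono : Monotone A := fun x y hxy => lintegral_mono_set (Metric.ball_subset_ball hxy)
  set m := max 1 t with hm
  have h1 : 1 ≤ m := le_max_left _ _
  have h2 : A m * ENNReal.ofReal (m + 1)⁻¹ * volume (Ioc m (m + 1)) ≤ ∫⁻ t in Ioc 1 (m + 1), A t * ENNReal.ofReal t⁻¹ := by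
    rw [← setLIntegral_const]
    refine (setLIntegral_mono_ae' measurableSet_Ioc (ae_of_all _ fun s hs => ?_)).trans
      (lintegral_mono_set (Ioc_subset_Ioc_left h1))
    refine mul_le_mul' (hAmono hs.1.le) (ENNReal.ofReal_le_ofReal ?_)
    exact inv_anti₀ (by linarith [hs.1]) hs.2
  have h3 := h2.trans_lt (hfin (m + 1))
  refine (hAmono (le_max_right 1 t)).trans_lt ?_
  by_contra htop
  rw [not_lt, top_le_iff] at htop
  rw [← hm] at htop
  have : (0 : ENNReal) < ENNReal.ofReal (m + 1)⁻¹ := by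
    rw [ENNReal.ofReal_pos]; positivity
  rw [htop, ENNReal.top_mul this.ne'] at h3
  simp at h3

/-- The growth lemma applied twice: circle means of a density are bounded in terms of the
logarithmic average of its disc integrals, outside a set of finite measure. -/
lemma exists_lintegral_circle_le {ψ : ℂ → ENNReal} (hψ : Measurable ψ)
    (hfin : ∀ r, ∫⁻ t in Ioc 1 r, (∫⁻ z in Metric.ball 0 t, ψ z) * ENNReal.ofReal t⁻¹ < ⊤)
    {ε : ℝ} (hε : 0 < ε) (hε1 : ε ≤ 1) :
    ∃ E : Set ℝ, MeasurableSet E ∧ volume E < ⊤ ∧ ∀ r, 1 < r → r ∉ E →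
      ∫⁻ θ in Ioo (-Real.pi) Real.pi, ψ (circleMap 0 r θ) ≤ 4 * ENNReal.ofReal (r ^ ε) *
        (1 + ∫⁻ t in Ioc 1 r, (∫⁻ z in Metric.ball 0 t, ψ z) * ENNReal.ofReal t⁻¹) ^ 4 := by
  set A : ℝ → ENNReal := fun t => ∫⁻ z in Metric.ball 0 t, ψ z with hA
  set H : ℝ → ENNReal := fun r => ∫⁻ t in Ioc 1 r, A t * ENNReal.ofReal t⁻¹ with hH
  set φ : ℝ → ENNReal := fun s => ENNReal.ofReal s *
      ∫⁻ θ in Ioo (-Real.pi) Real.pi, ψ (circleMap 0 s θ) with hφ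
  have hAm : Measurable A := measurable_setLIntegral_ball ψ
  have hAφ : ∀ t, A t = ∫⁻ s in Ioc 0 t, φ s := fun t => setLIntegral_ball_polar hψ t
  have hAfin : ∀ t, A t < ⊤ := setLIntegral_ball_lt_top hfin
  have hE1 := volume_primitive_rpow_lt_lt_top (φ := fun t => A t * ENNReal.ofReal t⁻¹)
    (hAm.mul (by fun_prop)) 1 hfin hε
  have hE2 := volume_primitive_rpow_lt_lt_top (φ := φ)
    ((by fun_prop : Measurable fun s : ℝ => ENNReal.ofReal s).mul (measurable_lintegral_circle hψ)) 0
    (fun r => by rw [← hAφ]; exact hAfin r) hε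
  refine ⟨toMeasurable volume _ ∪ toMeasurable volume _,
    (measurableSet_toMeasurable volume _).union (measurableSet_toMeasurable volume _),
    (measure_union_le _ _).trans_lt (ENNReal.add_lt_top.2
      ⟨(measure_toMeasurable _).trans_lt hE1, (measure_toMeasurable _).trans_lt hE2⟩), ?_⟩
  intro r hr hrE
  have hr0 : 0 < r := by linarith
  have hrE1 : A r * ENNReal.ofReal r⁻¹ ≤ (1 + H r) ^ (1 + ε) := by
    by_contra h
    exact hrE (Or.inl (subset_toMeasurable _ _ ⟨hr, not_le.1 h⟩))
  have hrE2 : φ r ≤ (1 + A r) ^ (1 + ε) := by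
    by_contra h
    refine hrE (Or.inr (subset_toMeasurable _ _ ⟨hr0, ?_⟩))
    rw [← hAφ]; exact not_le.1 h
  set R := ENNReal.ofReal r with hR
  have hR0 : R ≠ 0 := by simpa [hR] using hr0
  have hRtop : R ≠ ⊤ := ENNReal.ofReal_ne_top
  have hR1 : 1 ≤ R := by rw [hR, ← ENNReal.ofReal_one]; exact ENNReal.ofReal_le_ofReal hr.le
  set G := 1 + H r with hG
  have hG1 : 1 ≤ G := le_self_add
  rw [ENNReal.ofReal_inv_of_pos hr0, ← div_eq_mul_inv, ENNReal.div_le_iff hR0 hRtop] at hrE1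
  have h1 : 1 + A r ≤ 2 * (R * G ^ (2 : ℝ)) := by
    have hGG : G ^ (1 + ε) ≤ G ^ (2 : ℝ) :=
      ENNReal.rpow_le_rpow_of_exponent_le hG1 (by linarith)
    have hG2 : 1 ≤ G ^ (2 : ℝ) := ENNReal.one_le_rpow hG1 (by norm_num)
    have : 1 ≤ R * G ^ (2 : ℝ) := one_le_mul hR1 hG2
    rw [two_mul]
    refine add_le_add this (hrE1.trans ?_)
    rw [mul_comm]
    exact mul_le_mul' le_rfl hGG
  -- One factor R is split off from R^(1+ε) to cancel the Jacobian r in φ, so only r^ε survives.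
  -- Since ε ≤ 1, the other factors are bounded by 2^(1+ε) ≤ 4 and G^(2(1+ε)) ≤ G^4.
  have h2 : φ r ≤ R * (4 * R ^ ε * G ^ 4) := by
    refine hrE2.trans ((ENNReal.rpow_le_rpow h1 (by linarith)).trans ?_)
    rw [ENNReal.mul_rpow_of_nonneg _ _ (by linarith), ENNReal.mul_rpow_of_nonneg _ _ (by linarith),
      ENNReal.rpow_add _ _ hR0 hRtop, ENNReal.rpow_one, ← ENNReal.rpow_mul]
    have h3 : (2 : ENNReal) ^ (1 + ε) ≤ 4 := by
      refine (ENNReal.rpow_le_rpow_of_exponent_le (by norm_num) (by linarith : 1 + ε ≤ 2)).trans ?_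
      norm_num
    have h4 : G ^ (2 * (1 + ε)) ≤ G ^ 4 := by
      rw [← ENNReal.rpow_natCast]
      exact ENNReal.rpow_le_rpow_of_exponent_le hG1 (by norm_num; linarith)
    calc _ ≤ 4 * (R * R ^ ε * G ^ 4) := mul_le_mul' h3 (mul_le_mul' le_rfl h4)
      _ = _ := by ring
  rw [← ENNReal.ofReal_rpow_of_pos hr0]
  exact (ENNReal.mul_le_mul_iff_right hR0 hRtop).1 h2

/-! ### Radial integrals and the Fubini–Study weight on the plane. -/

lemma lintegral_comp_norm {g : ℝ → ENNReal} (hg : Measurable g) :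
    ∫⁻ z : ℂ, g ‖z‖ = ENNReal.ofReal (2 * Real.pi) * ∫⁻ s in Ioi (0 : ℝ), ENNReal.ofReal s * g s := by
  rw [lintegral_polar (fun z => g ‖z‖) (by fun_prop), ← lintegral_const_mul _ (by fun_prop)]
  refine setLIntegral_congr_fun measurableSet_Ioi fun s hs => ?_
  have hs : 0 < s := hs
  simp only [norm_circleMap_zero, abs_of_pos hs, setLIntegral_const, Real.volume_Ioo]
  rw [show Real.pi - -Real.pi = 2 * Real.pi by ring]
  ring

/-- The logarithmically tamed singularity `1 / (|z|² (1 + |log |z||)²)` is integrable. -/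
lemma lintegral_inv_sq_log_sq_lt_top :
    ∫⁻ z : ℂ, ENNReal.ofReal (1 / (‖z‖ ^ 2 * (1 + |Real.log ‖z‖|) ^ 2)) < ⊤ := by
  rw [lintegral_comp_norm (g := fun s => ENNReal.ofReal (1 / (s ^ 2 * (1 + |Real.log s|) ^ 2)))
    (by fun_prop)]
  refine ENNReal.mul_lt_top ENNReal.ofReal_lt_top ?_
  -- The substitution s = e^x turns ds / (s (1 + |log s|)²) into dx / (1 + |x|)², which settles the
  -- origin and infinity at once.
  rw [← Real.range_exp, ← image_univ, lintegral_image_eq_lintegral_abs_deriv_mul MeasurableSet.univ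
    (fun x _ => (Real.hasDerivAt_exp x).hasDerivWithinAt) Real.exp_injective.injOn, setLIntegral_univ]
  have h := (integrable_one_add_norm (E := ℝ) (μ := volume) (r := 2) (by simp)).lintegral_lt_top
  refine lt_of_le_of_lt (lintegral_mono fun x => ?_) h
  rw [← ENNReal.ofReal_mul (by positivity), ← ENNReal.ofReal_mul (by positivity), Real.log_exp,
    abs_of_pos (Real.exp_pos x)]
  refine ENNReal.ofReal_le_ofReal (le_of_eq ?_)
  rw [Real.rpow_neg (by positivity), Real.norm_eq_abs]
  norm_num
  field_simp

lemma lintegral_posLog_inv_norm_lt_top :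
    ∫⁻ z : ℂ, ENNReal.ofReal (Real.posLog ‖z‖⁻¹) < ⊤ := by
  rw [lintegral_comp_norm (g := fun s => ENNReal.ofReal (Real.posLog s⁻¹)) (by unfold Real.posLog; fun_prop)]
  refine ENNReal.mul_lt_top ENNReal.ofReal_lt_top ?_
  have : ∫⁻ s in Ioi (0 : ℝ), ENNReal.ofReal s * ENNReal.ofReal (Real.posLog s⁻¹)
      ≤ ∫⁻ s : ℝ, (Ioo (0 : ℝ) 1).indicator (fun _ => 1) s := by
    rw [← lintegral_indicator measurableSet_Ioi]
    refine lintegral_mono fun s => ?_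
    by_cases h0 : s ∈ Ioi (0 : ℝ)
    · rw [indicator_of_mem h0]
      have h0 : 0 < s := h0
      by_cases h1 : s < 1
      · rw [indicator_of_mem (mem_Ioo.2 ⟨h0, h1⟩), ← ENNReal.ofReal_mul h0.le, ENNReal.ofReal_le_one,
          Real.posLog_eq_log (by rw [abs_of_pos (by positivity)]; exact (one_le_inv₀ h0).2 h1.le)]
        have := Real.log_le_sub_one_of_pos (inv_pos.2 h0)
        calc s * Real.log s⁻¹ ≤ s * (s⁻¹ - 1) := by gcongr
          _ = 1 - s := by field_simp
          _ ≤ 1 := by linarith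
      · rw [(Real.posLog_eq_zero_iff _).2]
        · simp
        · rw [abs_of_pos (by positivity)]; exact inv_le_one_of_one_le₀ (not_lt.1 h1)
    · rw [indicator_of_notMem h0]; exact zero_le
  refine this.trans_lt ?_
  rw [lintegral_indicator measurableSet_Ioo]; simp

/-- The Fubini--Study density on the finite plane. -/
noncomputable def fsWeight (a : ℂ) : ℝ := (1 / Real.pi) * (1 / (1 + ‖a‖ ^ 2) ^ 2)

lemma fsWeight_nonneg (a : ℂ) : 0 ≤ fsWeight a := by unfold fsWeight; positivity

lemma continuous_fsWeight : Continuous fsWeight := by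
  unfold fsWeight
  refine continuous_const.mul (continuous_const.div (by fun_prop) fun a => by positivity)

lemma fsWeight_le_one (a : ℂ) : fsWeight a ≤ 1 := by
  unfold fsWeight
  have h1 : 1 / Real.pi ≤ 1 := (div_le_one Real.pi_pos).2 (by linarith [Real.pi_gt_three])
  have h2 : 1 / (1 + ‖a‖ ^ 2) ^ 2 ≤ 1 :=
    (div_le_one (by positivity)).2 (one_le_pow₀ (by nlinarith [norm_nonneg a]))
  exact mul_le_one₀ h1 (by positivity) h2

lemma lintegral_fsWeight : ∫⁻ a, ENNReal.ofReal (fsWeight a) = 1 := by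
  have hd : ∀ s ∈ Ioi (0 : ℝ), HasDerivAt (fun s : ℝ => -(1 / (2 * Real.pi)) * (1 + s ^ 2)⁻¹)
      (s * ((1 / Real.pi) * (1 / (1 + s ^ 2) ^ 2))) s := by
    intro s _
    have h1 : HasDerivAt (fun s : ℝ => 1 + s ^ 2) (2 * s) s := by
      simpa using (hasDerivAt_pow 2 s).const_add 1
    refine ((h1.inv (by positivity)).const_mul (-(1 / (2 * Real.pi)))).congr_deriv ?_
    field_simp
  have hnn : ∀ s ∈ Ioi (0 : ℝ), 0 ≤ s * ((1 / Real.pi) * (1 / (1 + s ^ 2) ^ 2)) := by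
    intro s hs
    have hs : 0 < s := hs
    positivity
  have hlim : Tendsto (fun s : ℝ => -(1 / (2 * Real.pi)) * (1 + s ^ 2)⁻¹) atTop
      (𝓝 (-(1 / (2 * Real.pi)) * 0)) := by
    refine (Tendsto.inv_tendsto_atTop ?_).const_mul _
    exact tendsto_atTop_add_const_left _ _ (tendsto_pow_atTop two_ne_zero)
  have hc : ContinuousWithinAt (fun s : ℝ => -(1 / (2 * Real.pi)) * (1 + s ^ 2)⁻¹) (Ici 0) 0 := by
    refine Continuous.continuousWithinAt ?_
    exact continuous_const.mul ((by fun_prop : Continuous fun s : ℝ => 1 + s ^ 2).inv₀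
      fun s => by positivity)
  have hint := integrableOn_Ioi_deriv_of_nonneg hc hd hnn hlim
  have hval := integral_Ioi_of_hasDerivAt_of_nonneg hc hd hnn hlim
  have h := lintegral_comp_norm
    (g := fun s => ENNReal.ofReal ((1 / Real.pi) * (1 / (1 + s ^ 2) ^ 2))) (by fun_prop)
  unfold fsWeight
  rw [h]
  have h2 : ∫⁻ s in Ioi (0 : ℝ), ENNReal.ofReal s *
      ENNReal.ofReal ((1 / Real.pi) * (1 / (1 + s ^ 2) ^ 2)) = ENNReal.ofReal (1 / (2 * Real.pi)) := by
    have : 1 / (2 * Real.pi)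
        = ∫ s in Ioi (0 : ℝ), s * ((1 / Real.pi) * (1 / (1 + s ^ 2) ^ 2)) := by
      rw [hval]; simp
    rw [this, ofReal_integral_eq_lintegral_ofReal hint]
    · refine setLIntegral_congr_fun measurableSet_Ioi fun s hs => ?_
      exact (ENNReal.ofReal_mul (le_of_lt hs)).symm
    · filter_upwards [ae_restrict_mem measurableSet_Ioi] with s hs using hnn s hs
  rw [h2, ← ENNReal.ofReal_mul (by positivity)]
  have : 2 * Real.pi * (1 / (2 * Real.pi)) = 1 := by field_simp
  rw [this, ENNReal.ofReal_one]

lemma lintegral_fsWeight_mul_posLog_lt_top :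
    ∫⁻ a, ENNReal.ofReal (fsWeight a * Real.posLog ‖a‖) < ⊤ := by
  have h := (integrable_one_add_norm (E := ℂ) (μ := volume) (r := 3)
    (by rw [Complex.finrank_real_complex]; norm_num)).const_mul 4 |>.lintegral_lt_top
  refine lt_of_le_of_lt (lintegral_mono fun a => ENNReal.ofReal_le_ofReal ?_) h
  have h1 : Real.posLog ‖a‖ ≤ 1 + ‖a‖ := by
    unfold Real.posLog
    refine max_le (by positivity) ?_
    exact (Real.log_le_self (norm_nonneg a)).trans (by linarith)
  have h2 : fsWeight a ≤ 4 / (1 + ‖a‖) ^ 4 := by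
    unfold fsWeight
    have h1 : 1 / Real.pi ≤ 1 := (div_le_one Real.pi_pos).2 (by linarith [Real.pi_gt_three])
    refine (mul_le_of_le_one_left (by positivity) h1).trans ?_
    rw [div_le_div_iff₀ (by positivity) (by positivity)]
    have : (1 + ‖a‖) ^ 2 ≤ 2 * (1 + ‖a‖ ^ 2) := by nlinarith [sq_nonneg (1 - ‖a‖)]
    have h3 : ((1 + ‖a‖) ^ 2) ^ 2 ≤ (2 * (1 + ‖a‖ ^ 2)) ^ 2 := pow_le_pow_left₀ (by positivity) this 2
    nlinarith
  calc fsWeight a * Real.posLog ‖a‖ ≤ 4 / (1 + ‖a‖) ^ 4 * (1 + ‖a‖) :=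
        mul_le_mul h2 h1 Real.posLog_nonneg (by positivity)
    _ = 4 * (1 + ‖a‖) ^ (-3 : ℝ) := by
        rw [Real.rpow_neg (by positivity)]
        norm_num
        field_simp

/-- The weight is at most 1 and Lebesgue measure is translation invariant. The point is that the
bound does not depend on w. -/
lemma lintegral_fsWeight_mul_posLog_inv_le (w : ℂ) :
    ∫⁻ a, ENNReal.ofReal (fsWeight a * Real.posLog ‖w - a‖⁻¹)
      ≤ ∫⁻ z : ℂ, ENNReal.ofReal (Real.posLog ‖z‖⁻¹) := by
  rw [← lintegral_sub_left_eq_self (fun z : ℂ => ENNReal.ofReal (Real.posLog ‖z‖⁻¹)) w]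
  exact lintegral_mono fun a => ENNReal.ofReal_le_ofReal
    (mul_le_of_le_one_left Real.posLog_nonneg (fsWeight_le_one a))

lemma abs_log_eq_posLog_add (x : ℝ) : |Real.log x| = Real.posLog x + Real.posLog x⁻¹ := by
  unfold Real.posLog
  rw [Real.log_inv]
  rcases le_total 0 (Real.log x) with h | h
  · rw [abs_of_nonneg h, max_eq_right h, max_eq_left (by linarith), add_zero]
  · rw [abs_of_nonpos h, max_eq_left h, max_eq_right (by linarith), zero_add]

lemma posLog_norm_sub_le (a b : ℂ) :
    Real.posLog ‖a - b‖ ≤ Real.posLog ‖a‖ + Real.posLog ‖b‖ + Real.log 2 := by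
  have := Real.posLog_norm_add_le a (-b)
  rw [norm_neg, ← sub_eq_add_neg] at this
  linarith

lemma lintegral_fsWeight_mul_abs_log_lt_top (b : ℂ) :
    ∫⁻ a, ENNReal.ofReal (fsWeight a * |Real.log ‖a - b‖|) < ⊤ := by
  have hle : ∀ a, ENNReal.ofReal (fsWeight a * |Real.log ‖a - b‖|)
      ≤ ENNReal.ofReal (fsWeight a * Real.posLog ‖a‖)
        + ENNReal.ofReal (Real.posLog ‖b‖ + Real.log 2) * ENNReal.ofReal (fsWeight a)
        + ENNReal.ofReal (fsWeight a * Real.posLog ‖b - a‖⁻¹) := by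
    intro a
    have h0 := fsWeight_nonneg a
    have hp : ∀ x, 0 ≤ Real.posLog x := fun x => Real.posLog_nonneg
    have h2 : 0 ≤ Real.log 2 := Real.log_nonneg (by norm_num)
    have h3 : 0 ≤ Real.posLog ‖b‖ + Real.log 2 := add_nonneg (hp _) h2
    rw [← ENNReal.ofReal_mul h3, ← ENNReal.ofReal_add (mul_nonneg h0 (hp _)) (mul_nonneg h3 h0),
      ← ENNReal.ofReal_add (add_nonneg (mul_nonneg h0 (hp _)) (mul_nonneg h3 h0))
        (mul_nonneg h0 (hp _))]
    refine ENNReal.ofReal_le_ofReal ?_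
    rw [abs_log_eq_posLog_add, norm_sub_rev b a]
    nlinarith [mul_le_mul_of_nonneg_left (posLog_norm_sub_le a b) h0]
  refine (lintegral_mono hle).trans_lt ?_
  have hm := continuous_fsWeight.measurable
  have hm' : Measurable Real.posLog := Real.continuous_posLog.measurable
  rw [lintegral_add_left (by fun_prop), lintegral_add_left (by fun_prop),
    lintegral_const_mul _ (by fun_prop), lintegral_fsWeight]
  refine ENNReal.add_lt_top.2 ⟨ENNReal.add_lt_top.2 ⟨lintegral_fsWeight_mul_posLog_lt_top, ?_⟩, ?_⟩
  · simp
  · exact (lintegral_fsWeight_mul_posLog_inv_le b).trans_lt lintegral_posLog_inv_norm_lt_top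

/-! ### The singular density and its integrability. -/

/-- The total logarithmic size of the distances to a finite set of points. -/
noncomputable def logSize (F : Finset ℂ) (w : ℂ) : ℝ := 1 + ∑ b ∈ F, |Real.log ‖w - b‖|

lemma one_le_logSize (F : Finset ℂ) (w : ℂ) : 1 ≤ logSize F w := by
  unfold logSize
  linarith [Finset.sum_nonneg fun b (_ : b ∈ F) => abs_nonneg (Real.log ‖w - b‖)]

lemma abs_log_le_logSize {F : Finset ℂ} {b : ℂ} (hb : b ∈ F) (w : ℂ) :
    1 + |Real.log ‖w - b‖| ≤ logSize F w := by
  unfold logSize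
  have := Finset.single_le_sum (f := fun b => |Real.log ‖w - b‖|) (fun b _ => abs_nonneg _) hb
  linarith

lemma measurable_logSize (F : Finset ℂ) : Measurable (logSize F) := by
  unfold logSize
  fun_prop

/-- The part of the singular density with poles of order two at the points of `F`, and the decay
`|w|⁻²` at infinity. -/
noncomputable def polarDensity (F : Finset ℂ) (w : ℂ) : ℝ :=
  max 1 ‖w‖ ^ (2 * (F.card - 1)) / ∏ b ∈ F, ‖w - b‖ ^ 2

lemma polarDensity_nonneg (F : Finset ℂ) (w : ℂ) : 0 ≤ polarDensity F w := by
  unfold polarDensity; positivity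

/-- A partial fraction estimate: |a - b|² ≤ 2(|w - a|² + |w - b|²) separates the two poles, and |w|²
≤ 2|w - a|² + 2|a|² handles large w. -/
lemma sq_max_div_le {a b : ℂ} (hab : a ≠ b) :
    ∃ C : ℝ, 0 ≤ C ∧ ∀ w : ℂ, max 1 ‖w‖ ^ 2 / (‖w - a‖ ^ 2 * ‖w - b‖ ^ 2)
      ≤ C * (1 / ‖w - a‖ ^ 2 + 1 / ‖w - b‖ ^ 2) := by
  have hd : 0 < ‖a - b‖ := norm_pos_iff.2 (sub_ne_zero.2 hab)
  refine ⟨2 / ‖a - b‖ ^ 2 * (1 + 2 * ‖a‖ ^ 2) + 2, by positivity, fun w => ?_⟩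
  -- At a pole the left side is 0 by the convention for division by zero.
  by_cases ha : ‖w - a‖ = 0
  · simp [ha]; positivity
  by_cases hb : ‖w - b‖ = 0
  · simp [hb]; positivity
  have ha' : 0 < ‖w - a‖ := lt_of_le_of_ne (norm_nonneg _) (Ne.symm ha)
  have hb' : 0 < ‖w - b‖ := lt_of_le_of_ne (norm_nonneg _) (Ne.symm hb)
  have h1 : ‖a - b‖ ^ 2 ≤ 2 * (‖w - a‖ ^ 2 + ‖w - b‖ ^ 2) := by
    have : ‖a - b‖ ≤ ‖w - a‖ + ‖w - b‖ := by
      have := norm_sub_le (w - b) (w - a)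
      rw [show w - b - (w - a) = a - b by ring] at this
      linarith
    nlinarith [sq_nonneg (‖w - a‖ - ‖w - b‖)]
  have h2 : ‖w‖ ^ 2 ≤ 2 * ‖w - a‖ ^ 2 + 2 * ‖a‖ ^ 2 := by
    have : ‖w‖ ≤ ‖w - a‖ + ‖a‖ := by
      have := norm_add_le (w - a) a
      rwa [sub_add_cancel] at this
    nlinarith [sq_nonneg (‖w - a‖ - ‖a‖), norm_nonneg w]
  have h3 : max 1 ‖w‖ ^ 2 ≤ 1 + ‖w‖ ^ 2 := by
    rcases max_cases 1 ‖w‖ with h | h <;> rw [h.1] <;> nlinarith [norm_nonneg w]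
  have h4 : 1 ≤ 2 / ‖a - b‖ ^ 2 * (‖w - a‖ ^ 2 + ‖w - b‖ ^ 2) := by
    rw [div_mul_eq_mul_div, one_le_div (by positivity)]
    exact h1
  have h5 : 1 / ‖w - a‖ ^ 2 + 1 / ‖w - b‖ ^ 2
      = (‖w - a‖ ^ 2 + ‖w - b‖ ^ 2) / (‖w - a‖ ^ 2 * ‖w - b‖ ^ 2) := by
    field_simp; ring
  rw [h5, ← mul_div_assoc]
  refine div_le_div_of_nonneg_right ?_ (by positivity)
  nlinarith [mul_le_mul_of_nonneg_left h4 (by positivity : 0 ≤ 1 + 2 * ‖a‖ ^ 2), sq_nonneg ‖w - b‖]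

/-- Each new point contributes the factor max(1, |w|)² / |w - a|², and `sq_max_div_le` splits its
product with every existing term 1 / |w - b|². -/
lemma exists_polarDensity_le {F : Finset ℂ} (hF : F.Nonempty) :
    ∃ C : ℝ, 0 ≤ C ∧ ∀ w, polarDensity F w ≤ C * ∑ b ∈ F, 1 / ‖w - b‖ ^ 2 := by
  induction hF using Finset.Nonempty.cons_induction with
  | singleton a => exact ⟨1, zero_le_one, fun w => by simp [polarDensity]⟩
  | cons a s ha hs ih =>
    obtain ⟨C, hC, h⟩ := ih
    have hne : ∀ b ∈ s, a ≠ b := fun b hb hab => ha (hab ▸ hb)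
    choose! D hD0 hD using fun b (hb : b ∈ s) => sq_max_div_le (hne b hb)
    refine ⟨C * ∑ b ∈ s, D b, mul_nonneg hC (Finset.sum_nonneg hD0), fun w => ?_⟩
    have h1 : polarDensity (Finset.cons a s ha) w
        = polarDensity s w * (max 1 ‖w‖ ^ 2 / ‖w - a‖ ^ 2) := by
      unfold polarDensity
      rw [Finset.prod_cons, Finset.card_cons]
      have : 2 * (s.card + 1 - 1) = 2 * (s.card - 1) + 2 := by
        have := hs.card_pos; omega
      rw [this, pow_add, mul_comm (‖w - a‖ ^ 2), mul_div_mul_comm]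
    rw [h1, mul_assoc]
    refine (mul_le_mul_of_nonneg_right (h w) (by positivity)).trans ?_
    rw [mul_assoc]
    refine mul_le_mul_of_nonneg_left ?_ hC
    rw [Finset.sum_mul, Finset.sum_mul]
    refine Finset.sum_le_sum fun b hb => ?_
    have h2 := hD b hb w
    rw [Finset.sum_cons]
    have h3 : 1 / ‖w - b‖ ^ 2 ≤ ∑ b ∈ s, 1 / ‖w - b‖ ^ 2 :=
      Finset.single_le_sum (f := fun b => 1 / ‖w - b‖ ^ 2) (fun b _ => by positivity) hb
    calc 1 / ‖w - b‖ ^ 2 * (max 1 ‖w‖ ^ 2 / ‖w - a‖ ^ 2)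
        = max 1 ‖w‖ ^ 2 / (‖w - a‖ ^ 2 * ‖w - b‖ ^ 2) := by
          rw [div_mul_div_comm, one_mul, mul_comm (‖w - b‖ ^ 2)]
      _ ≤ _ := h2
      _ ≤ _ := mul_le_mul_of_nonneg_left (by linarith) (hD0 b hb)

/-- The singular density on the plane used to derive the second main theorem. -/
noncomputable def singularDensity (F : Finset ℂ) (w : ℂ) : ℝ :=
  polarDensity F w / logSize F w ^ 3

lemma singularDensity_nonneg (F : Finset ℂ) (w : ℂ) : 0 ≤ singularDensity F w :=
  div_nonneg (polarDensity_nonneg F w) (pow_nonneg (zero_le_one.trans (one_le_logSize F w)) 3)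

lemma measurable_singularDensity (F : Finset ℂ) : Measurable (singularDensity F) := by
  have := measurable_logSize F
  unfold singularDensity polarDensity
  fun_prop

/-- This explains the cube in `singularDensity`: two powers of `logSize` make the double poles and
the |w|⁻² decay at infinity integrable, and the third pays for the logarithmic error of the first
main theorem. -/
lemma lintegral_singularDensity_mul_logSize_lt_top {F : Finset ℂ} (hF : F.Nonempty) :
    ∫⁻ w, ENNReal.ofReal (singularDensity F w * logSize F w) < ⊤ := by
  obtain ⟨C, hC, h⟩ := exists_polarDensity_le hF
  have hle : ∀ w, ENNReal.ofReal (singularDensity F w * logSize F w)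
      ≤ ENNReal.ofReal C * ∑ b ∈ F,
        ENNReal.ofReal (1 / (‖w - b‖ ^ 2 * (1 + |Real.log ‖w - b‖|) ^ 2)) := by
    intro w
    rw [← ENNReal.ofReal_sum_of_nonneg (fun b _ => by positivity), ← ENNReal.ofReal_mul hC]
    refine ENNReal.ofReal_le_ofReal ?_
    have h1 := one_le_logSize F w
    have h2 : singularDensity F w * logSize F w = polarDensity F w / logSize F w ^ 2 := by
      unfold singularDensity; field_simp
    rw [h2]
    refine (div_le_div_of_nonneg_right (h w) (by positivity)).trans ?_
    rw [mul_div_assoc, Finset.sum_div]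
    refine mul_le_mul_of_nonneg_left (Finset.sum_le_sum fun b hb => ?_) hC
    rw [div_div]
    rcases (norm_nonneg (w - b)).eq_or_lt with h0 | h0
    · simp [← h0]
    · refine one_div_le_one_div_of_le (by positivity) ?_
      gcongr
      exact abs_log_le_logSize hb w
  refine (lintegral_mono hle).trans_lt ?_
  rw [lintegral_const_mul _ (by fun_prop), lintegral_finsetSum _ (fun b _ => by fun_prop)]
  refine ENNReal.mul_lt_top ENNReal.ofReal_lt_top (ENNReal.sum_lt_top.2 fun b _ => ?_)
  rw [lintegral_sub_right_eq_self
    (fun z : ℂ => ENNReal.ofReal (1 / (‖z‖ ^ 2 * (1 + |Real.log ‖z‖|) ^ 2))) b]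
  exact lintegral_inv_sq_log_sq_lt_top

/-! ### Regular points, critical values and the area formula for f. -/

section
variable {f : ℂ → ℂ}

lemma countable_compl_of_mem_codiscrete {s : Set ℂ} (hs : s ∈ codiscrete ℂ) : sᶜ.Countable := by
  refine (HereditarilyLindelofSpace.isLindelof _).countable_of_isDiscrete ?_
  have := isDiscrete_of_codiscreteWithin (U := univ) (s := sᶜ) (by rwa [compl_compl])
  simpa using this

/-- The points at which `f` is a local biholomorphism. -/
def regularSet (f : ℂ → ℂ) : Set ℂ := {z | AnalyticAt ℂ f z ∧ deriv f z ≠ 0}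

lemma isOpen_regularSet (f : ℂ → ℂ) : IsOpen (regularSet f) := by
  rw [isOpen_iff_mem_nhds]
  rintro z ⟨h1, h2⟩
  filter_upwards [h1.eventually_analyticAt, h1.deriv.continuousAt.eventually_ne h2] with w h3 h4
  exact ⟨h3, h4⟩

lemma eventually_codiscrete_ne_zero {g : ℂ → ℂ} (hg : Meromorphic g)
    (h : ∀ z, meromorphicOrderAt g z ≠ ⊤) : ∀ᶠ z in codiscrete ℂ, g z ≠ 0 :=
  hg.meromorphicOn.eventually_codiscreteWithin_apply_ne_zero fun z _ => h z

lemma regularSet_mem_codiscrete (hf : Meromorphic f) (hnc : MeromorphicNonconstant f) :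
    regularSet f ∈ codiscrete ℂ := by
  filter_upwards [hf.meromorphicOn.analyticAt_mem_codiscreteWithin (U := univ),
    eventually_codiscrete_ne_zero hf.deriv (meromorphicOrderAt_deriv_ne_top hf hnc)] with z h1 h2
  exact ⟨h1, h2⟩

lemma countable_compl_regularSet (hf : Meromorphic f) (hnc : MeromorphicNonconstant f) :
    (regularSet f)ᶜ.Countable := countable_compl_of_mem_codiscrete (regularSet_mem_codiscrete hf hnc)

/-- The weighted sum over the regular points at which the value `a` is taken. -/
noncomputable def regularCounting (f : ℂ → ℂ) (r : ℝ) (a : ℂ) : ENNReal :=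
  ∑' z, (regularSet f ∩ f ⁻¹' {a}).indicator (fun z => ENNReal.ofReal (logWeight r z)) z

/-- The points outside `regularSet` are countable, hence null, so the area formula on the regular
set computes the whole integral. -/
lemma lintegral_logWeight_mul_eq (hf : Meromorphic f) (hnc : MeromorphicNonconstant f)
    {ρ : ℂ → ENNReal} (hρ : Measurable ρ) (r : ℝ) :
    ∫⁻ z, ENNReal.ofReal (logWeight r z) * (ρ (f z) * ENNReal.ofReal (‖deriv f z‖ ^ 2))
      = ∫⁻ a, ρ a * regularCounting f r a := by
  unfold regularCounting
  rw [← (lintegral_mul_comp_mul_deriv_sq (isOpen_regularSet f) (fun _ hz => hz)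
    (continuous_logWeight r).measurable.ennreal_ofReal hρ).2]
  rw [setLIntegral_congr (t := univ), setLIntegral_univ]
  · simp_rw [mul_assoc]
  · rw [ae_eq_univ]
    exact (countable_compl_regularSet hf hnc).measure_zero _

lemma measurable_regularCounting (f : ℂ → ℂ) (r : ℝ) : Measurable (regularCounting f r) :=
  (lintegral_mul_comp_mul_deriv_sq (isOpen_regularSet f) (fun _ hz => hz)
    (continuous_logWeight r).measurable.ennreal_ofReal (measurable_const (a := 0))).1

lemma takesValueAt_of_mem_regularSet {z : ℂ} (hz : z ∈ regularSet f) :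
    TakesValueAt f (f z : ℂ) z :=
  takesValueAt_coe_iff_tendsto.2 (hz.1.continuousAt.tendsto.mono_left nhdsWithin_le_nhds)

lemma regularCounting_le (hf : Meromorphic f) (hnc : MeromorphicNonconstant f) {r : ℝ}
    (hr : 1 ≤ r) (a : ℂ) :
    regularCounting f r a ≤ ENNReal.ofReal (simpleCounting f a r) := by
  have hfin := finite_takesValueAt hf hnc a r
  rw [simpleCounting_eq_sum hr (s := hfin.toFinset) (fun z h h' => hfin.mem_toFinset.2 ⟨h, h'⟩)
    (fun z hz => (hfin.mem_toFinset.1 hz).2),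
    ENNReal.ofReal_sum_of_nonneg fun z _ => logWeight_nonneg r z, regularCounting,
    tsum_eq_sum (s := hfin.toFinset)]
  · exact Finset.sum_le_sum fun z _ => indicator_le_self _ _ z
  · intro z hz
    by_cases h : z ∈ regularSet f ∩ f ⁻¹' {a}
    · have h2 : f z = a := h.2
      have h1 : ¬ ‖z‖ ≤ r := fun h' =>
        hz (hfin.mem_toFinset.2 ⟨h', h2 ▸ takesValueAt_of_mem_regularSet h.1⟩)
      rw [indicator_of_mem h, logWeight_eq_zero (by linarith)
        ((not_le.1 h1).le.trans (le_max_right _ _)), ENNReal.ofReal_zero]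
    · exact indicator_of_notMem h _

/-- The finite values taken at a critical point or a singular point of `f`. -/
def criticalValues (f : ℂ → ℂ) : Set ℂ := {a | ∃ z ∈ (regularSet f)ᶜ, TakesValueAt f (a : OnePoint ℂ) z}

lemma countable_criticalValues (hf : Meromorphic f) (hnc : MeromorphicNonconstant f) :
    (criticalValues f).Countable := by
  have : criticalValues f
      = ⋃ z ∈ (regularSet f)ᶜ, {a : ℂ | TakesValueAt f (a : OnePoint ℂ) z} := by
    ext a; simp [criticalValues]
  rw [this]
  refine (countable_compl_regularSet hf hnc).biUnion fun z _ => Set.Subsingleton.countable ?_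
  intro a ha b hb
  exact OnePoint.coe_injective (takesValueAt_unique ha hb)

lemma mem_regularSet_of_takesValueAt {a z : ℂ} (ha : a ∉ criticalValues f)
    (hz : TakesValueAt f (a : OnePoint ℂ) z) : z ∈ regularSet f ∧ f z = a := by
  have h1 : z ∈ regularSet f := by
    by_contra h
    exact ha ⟨z, h, hz⟩
  exact ⟨h1, OnePoint.coe_injective (takesValueAt_unique (takesValueAt_of_mem_regularSet h1) hz)⟩

lemma le_regularCounting (hf : Meromorphic f) (hnc : MeromorphicNonconstant f) {r : ℝ}
    (hr : 1 ≤ r) {a : ℂ} (ha : a ∉ criticalValues f) :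
    ENNReal.ofReal (simpleCounting f a r) ≤ regularCounting f r a := by
  have hfin := finite_takesValueAt hf hnc a r
  rw [simpleCounting_eq_sum hr (s := hfin.toFinset) (fun z h h' => hfin.mem_toFinset.2 ⟨h, h'⟩)
    (fun z hz => (hfin.mem_toFinset.1 hz).2),
    ENNReal.ofReal_sum_of_nonneg fun z _ => logWeight_nonneg r z, regularCounting]
  refine le_trans (Finset.sum_le_sum fun z hz => ?_) (ENNReal.sum_le_tsum hfin.toFinset)
  rw [indicator_of_mem]
  exact mem_regularSet_of_takesValueAt ha (hfin.mem_toFinset.1 hz).2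

-- Away from the critical values every a-point is simple, so counting with and without multiplicity
-- agrees up to the contribution at radius 1.
open ValueDistribution in
lemma logCounting_le_simpleCounting_add (hf : Meromorphic f) (hnc : MeromorphicNonconstant f)
    {r : ℝ} (hr : 1 ≤ r) {a : ℂ} (ha : a ∉ criticalValues f) :
    logCounting f a r ≤ simpleCounting f a r + logCounting f a 1 := by
  classical
  have h := mul_sum_simpleCounting_le hf hnc (k := -1)
      (E := -(MeromorphicOn.divisor (fun w => f w - a) univ)⁺)
      (B := {(a : OnePoint ℂ)}) (fun z => ?_) hr
  · simp only [Finset.sum_singleton, map_neg, Pi.neg_apply, ← logCounting_coe, Int.cast_neg,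
      Int.cast_one] at h
    linarith
  · simp only [Finset.sum_singleton]
    by_cases hz : TakesValueAt f (a : OnePoint ℂ) z
    · obtain ⟨h1, h2⟩ := mem_regularSet_of_takesValueAt ha hz
      have h3 : MeromorphicOn.divisor (fun w => f w - a) univ z = 1 := by
        rw [divisor_sub_apply hf, AnalyticAt.meromorphicOrderAt_eq (h1.1.fun_sub analyticAt_const),
          ← h2, h1.1.analyticOrderAt_sub_eq_one_of_deriv_ne_zero h1.2]
        simp
      simp [hz, posPart_def, h3]
    · have h3 : ¬ 0 < MeromorphicOn.divisor (fun w => f w - a) univ z :=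
        fun h => hz ((takesValueAt_coe_iff_divisor hf hnc).2 h)
      simp only [posPart_def, Function.locallyFinsuppWithin.coe_neg, Pi.neg_apply,
        Function.locallyFinsuppWithin.max_apply, Function.locallyFinsuppWithin.coe_zero,
        Pi.zero_apply, if_neg hz]
      omega

lemma intervalIntegral_setIntegral_ball_div_eq {g : ℂ → ℝ} (hg : Measurable g) (hg0 : ∀ z, 0 ≤ g z)
    (hfin : ∀ r, ∫⁻ t in Ioc 1 r, (∫⁻ z in Metric.ball 0 t, ENNReal.ofReal (g z))
      * ENNReal.ofReal t⁻¹ < ⊤) {r : ℝ} (hr : 1 ≤ r) :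
    ∫ t in (1 : ℝ)..r, (∫ z in Metric.ball (0 : ℂ) t, g z) / t
      = (∫⁻ z, ENNReal.ofReal (logWeight r z) * ENNReal.ofReal (g z)).toReal := by
  rw [← lintegral_setLIntegral_ball_div hg.ennreal_ofReal r hr,
    intervalIntegral.integral_of_le hr]
  have h1 : ∀ t, ∫ z in Metric.ball (0 : ℂ) t, g z
      = (∫⁻ z in Metric.ball (0 : ℂ) t, ENNReal.ofReal (g z)).toReal := fun t =>
    integral_eq_lintegral_of_nonneg_ae (ae_of_all _ hg0) hg.aestronglyMeasurable
  simp_rw [h1]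
  have hm := (measurable_setLIntegral_ball (fun z => ENNReal.ofReal (g z))).ennreal_toReal
  rw [integral_eq_lintegral_of_nonneg_ae]
  · congr 1
    refine setLIntegral_congr_fun measurableSet_Ioc fun t ht => ?_
    have ht0 : 0 < t := one_pos.trans ht.1
    simp only [div_eq_mul_inv]
    rw [ENNReal.ofReal_mul ENNReal.toReal_nonneg,
      ENNReal.ofReal_toReal (setLIntegral_ball_lt_top hfin t).ne]
  · filter_upwards [ae_restrict_mem measurableSet_Ioc] with t ht
    exact div_nonneg ENNReal.toReal_nonneg (by linarith [ht.1])
  · exact (hm.div measurable_id).aestronglyMeasurable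

end

/-! ### Comparison of the Ahlfors and Nevanlinna characteristics. -/

section
variable {f : ℂ → ℂ}

/-- The error term in the first main theorem at the value `a`. -/
noncomputable def fmtError (b : ℂ) (K : ℝ) (a : ℂ) : ℝ :=
  Real.posLog ‖a‖ + Real.log 2 + (|Real.log ‖a - b‖| + K)

lemma measurable_fmtError (b : ℂ) (K : ℝ) : Measurable (fmtError b K) := by
  have : Measurable Real.posLog := Real.continuous_posLog.measurable
  unfold fmtError
  fun_prop

lemma fmtError_nonneg (b : ℂ) {K : ℝ} (hK : 0 ≤ K) (a : ℂ) : 0 ≤ fmtError b K a := by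
  have h1 : 0 ≤ Real.posLog ‖a‖ := Real.posLog_nonneg
  have h2 : 0 ≤ Real.log 2 := Real.log_nonneg (by norm_num)
  unfold fmtError
  positivity

open ValueDistribution in
lemma exists_fmtError (hf : Meromorphic f) :
    ∃ b : ℂ, ∃ K : ℝ, 0 ≤ K ∧ ∀ a, a ≠ b → ∀ r : ℝ, r ≠ 0 →
      |logCounting f a r + proximity f a r - characteristic f ⊤ r| ≤ fmtError b K a := by
  obtain ⟨b, K, hK, h⟩ := exists_abs_log_trailingCoeff_le hf
  refine ⟨b, K, hK, fun a ha r hr => ?_⟩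
  refine (abs_logCounting_add_proximity_sub_characteristic_le hf a hr).trans ?_
  unfold fmtError
  linarith [h a ha]

open ValueDistribution in
lemma simpleCounting_coe_le_logCounting (hf : Meromorphic f) (hnc : MeromorphicNonconstant f)
    (a : ℂ) {r : ℝ} (hr : 1 ≤ r) : simpleCounting f a r ≤ logCounting f a r := by
  classical
  have h := mul_sum_simpleCounting_le hf hnc (k := 1)
      (E := (MeromorphicOn.divisor (fun w => f w - a) univ)⁺)
      (B := {(a : OnePoint ℂ)}) (fun z => ?_) hr
  · simp only [Finset.sum_singleton, Int.cast_one, one_mul, ← logCounting_coe] at h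
    have h1 : 0 ≤ logCounting f a 1 := logCounting_nonneg le_rfl
    linarith
  · simp only [Finset.sum_singleton, takesValueAt_coe_iff_divisor hf hnc, posPart_def]
    simp only [Function.locallyFinsuppWithin.max_apply, Function.locallyFinsuppWithin.coe_zero,
      Pi.zero_apply]
    split_ifs <;> omega

open ValueDistribution in
/-- Averaged upper bound from the first main theorem. -/
lemma lintegral_logWeight_mul_le (hf : Meromorphic f) (hnc : MeromorphicNonconstant f) {b : ℂ}
    {K : ℝ} (hfmt : ∀ a, a ≠ b → ∀ r : ℝ, r ≠ 0 →
      |logCounting f a r + proximity f a r - characteristic f ⊤ r| ≤ fmtError b K a)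
    {ρ : ℂ → ℝ} (hρ : Measurable ρ) (hρ0 : ∀ a, 0 ≤ ρ a) {r : ℝ} (hr : 1 ≤ r) :
    ∫⁻ z, ENNReal.ofReal (logWeight r z) * ENNReal.ofReal (ρ (f z) * ‖deriv f z‖ ^ 2)
      ≤ ∫⁻ a, ENNReal.ofReal (ρ a * (characteristic f ⊤ r + fmtError b K a)) := by
  simp_rw [fun z => ENNReal.ofReal_mul (hρ0 (f z)) (q := ‖deriv f z‖ ^ 2)]
  rw [lintegral_logWeight_mul_eq hf hnc hρ.ennreal_ofReal r]
  refine lintegral_mono_ae ?_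
  have hb : ∀ᵐ a : ℂ, a ≠ b := by simp [ae_iff]
  filter_upwards [hb] with a ha
  rw [ENNReal.ofReal_mul (hρ0 a)]
  refine mul_le_mul' le_rfl ((regularCounting_le hf hnc hr a).trans (ENNReal.ofReal_le_ofReal ?_))
  refine (simpleCounting_coe_le_logCounting hf hnc a hr).trans ?_
  have h1 := (abs_le.1 (hfmt a ha r (by linarith))).2
  have h2 := proximity_nonneg (f := f) (a := a) r
  simp only [Pi.zero_apply] at h2
  linarith

/-- Only an inequality, so that no integrability is needed: a non-integrable circle average is 0 by
convention. -/
lemma ofReal_circleAverage_le {u : ℂ → ℝ} (hu : ∀ z, 0 ≤ u z) (r : ℝ) :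
    ENNReal.ofReal (Real.circleAverage u 0 r)
      ≤ ENNReal.ofReal (2 * Real.pi)⁻¹ * ∫⁻ θ in Ioc 0 (2 * Real.pi),
        ENNReal.ofReal (u (circleMap 0 r θ)) := by
  rw [Real.circleAverage_def, smul_eq_mul, ENNReal.ofReal_mul (by positivity),
    intervalIntegral.integral_of_le (by positivity)]
  refine mul_le_mul' le_rfl ?_
  by_cases h : IntegrableOn (fun θ => u (circleMap 0 r θ)) (Ioc 0 (2 * Real.pi))
  · rw [ofReal_integral_eq_lintegral_ofReal h (ae_of_all _ fun θ => hu _)]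
  · rw [integral_undef h]; simp

-- Tonelli moves the average over targets inside the circle mean, where it is bounded uniformly in
-- the value of f; hence the bound is independent of r and of f.
open ValueDistribution in
lemma lintegral_fsWeight_mul_proximity_le (hf : Meromorphic f) (r : ℝ) :
    ∫⁻ a : ℂ, ENNReal.ofReal (fsWeight a) * ENNReal.ofReal (proximity f a r)
      ≤ ∫⁻ z : ℂ, ENNReal.ofReal (Real.posLog ‖z‖⁻¹) := by
  set M := ∫⁻ z : ℂ, ENNReal.ofReal (Real.posLog ‖z‖⁻¹) with hM
  have hpl : Measurable Real.posLog := Real.continuous_posLog.measurable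
  have hfm : Measurable f := hf.measurable
  have hcm : Measurable fun θ => circleMap 0 r θ := (continuous_circleMap 0 r).measurable
  have hfw := continuous_fsWeight.measurable
  have h1 : ∀ a : ℂ, ENNReal.ofReal (fsWeight a) * ENNReal.ofReal (proximity f a r)
      ≤ ENNReal.ofReal (2 * Real.pi)⁻¹ * ∫⁻ θ in Ioc 0 (2 * Real.pi),
        ENNReal.ofReal (fsWeight a * Real.posLog ‖f (circleMap 0 r θ) - a‖⁻¹) := by
    intro a
    rw [proximity_coe]
    refine (mul_le_mul' le_rfl (ofReal_circleAverage_le (fun z => Real.posLog_nonneg) r)).trans ?_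
    rw [← mul_assoc, mul_comm (ENNReal.ofReal (fsWeight a)), mul_assoc,
      ← lintegral_const_mul _ (by fun_prop)]
    simp_rw [← ENNReal.ofReal_mul (fsWeight_nonneg a)]
    exact le_rfl
  refine (lintegral_mono h1).trans ?_
  rw [lintegral_const_mul' _ _ ENNReal.ofReal_ne_top, lintegral_lintegral_swap]
  · refine (mul_le_mul' le_rfl (lintegral_mono fun θ =>
      lintegral_fsWeight_mul_posLog_inv_le (f (circleMap 0 r θ)))).trans ?_
    rw [setLIntegral_const, Real.volume_Ioc, sub_zero, mul_comm _ (ENNReal.ofReal (2 * Real.pi)),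
      ← mul_assoc, ← ENNReal.ofReal_mul (by positivity), inv_mul_cancel₀ (by positivity), ENNReal.ofReal_one, one_mul]
  · refine Measurable.aemeasurable ?_
    have : Measurable fun p : ℂ × ℝ => f (circleMap 0 r p.2) := hfm.comp (hcm.comp measurable_snd)
    exact ENNReal.measurable_ofReal.comp ((hfw.comp measurable_fst).mul
      (hpl.comp ((this.sub measurable_fst).norm.inv)))

lemma lintegral_fsWeight_mul_fmtError_lt_top (b : ℂ) {K : ℝ} (hK : 0 ≤ K) :
    ∫⁻ a, ENNReal.ofReal (fsWeight a * fmtError b K a) < ⊤ := by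
  have h2 : 0 ≤ Real.log 2 := Real.log_nonneg (by norm_num)
  have hm := continuous_fsWeight.measurable
  have hm' : Measurable Real.posLog := Real.continuous_posLog.measurable
  have h : ∀ a, ENNReal.ofReal (fsWeight a * fmtError b K a)
      = ENNReal.ofReal (fsWeight a * Real.posLog ‖a‖)
        + ENNReal.ofReal (Real.log 2 + K) * ENNReal.ofReal (fsWeight a)
        + ENNReal.ofReal (fsWeight a * |Real.log ‖a - b‖|) := by
    intro a
    have h0 := fsWeight_nonneg a
    have hp : 0 ≤ Real.posLog ‖a‖ := Real.posLog_nonneg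
    rw [← ENNReal.ofReal_mul (by positivity), ← ENNReal.ofReal_add (by positivity) (by positivity),
      ← ENNReal.ofReal_add (by positivity) (by positivity)]
    unfold fmtError
    congr 1; ring
  simp_rw [h]
  rw [lintegral_add_left (by fun_prop), lintegral_add_left (by fun_prop),
    lintegral_const_mul _ (by fun_prop), lintegral_fsWeight]
  refine ENNReal.add_lt_top.2 ⟨ENNReal.add_lt_top.2 ⟨lintegral_fsWeight_mul_posLog_lt_top, ?_⟩,
    lintegral_fsWeight_mul_abs_log_lt_top b⟩
  simp

lemma fubiniStudyDensity_eq (f : ℂ → ℂ) (z : ℂ) :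
    fubiniStudyDensity f z = fsWeight (f z) * ‖deriv f z‖ ^ 2 := by
  unfold fubiniStudyDensity fsWeight; ring

lemma measurable_fubiniStudyDensity (hf : Meromorphic f) : Measurable (fubiniStudyDensity f) := by
  have h1 := hf.measurable
  have h2 := hf.deriv.measurable
  unfold fubiniStudyDensity
  fun_prop

open ValueDistribution in
/-- The Ahlfors and Nevanlinna characteristics differ by a bounded amount. -/
lemma exists_abs_ahlforsCharacteristic_sub_le (hf : Meromorphic f)
    (hnc : MeromorphicNonconstant f) :
    ∃ C : ℝ, ∀ r, 1 ≤ r → |ahlforsCharacteristic f r - characteristic f ⊤ r| ≤ C := by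
  obtain ⟨b, K, hK, hfmt⟩ := exists_fmtError hf
  have hfs := continuous_fsWeight.measurable
  have hfe := measurable_fmtError b K
  set I := ∫⁻ a, ENNReal.ofReal (fsWeight a * fmtError b K a) with hI
  have hIfin : I < ⊤ := lintegral_fsWeight_mul_fmtError_lt_top b hK
  set M := ∫⁻ z : ℂ, ENNReal.ofReal (Real.posLog ‖z‖⁻¹) with hM
  have hMfin : M < ⊤ := lintegral_posLog_inv_norm_lt_top
  set A : ℝ → ENNReal := fun r => ∫⁻ z, ENNReal.ofReal (logWeight r z) *
    ENNReal.ofReal (fubiniStudyDensity f z) with hA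
  have hT0 : ∀ r, 1 ≤ r → 0 ≤ characteristic f ⊤ r := fun r hr => characteristic_nonneg hr
  have hupper : ∀ r, 1 ≤ r → A r ≤ ENNReal.ofReal (characteristic f ⊤ r) + I := by
    intro r hr
    simp only [hA, fubiniStudyDensity_eq]
    refine (lintegral_logWeight_mul_le hf hnc hfmt hfs fsWeight_nonneg hr).trans (le_of_eq ?_)
    have : ∀ a, ENNReal.ofReal (fsWeight a * (characteristic f ⊤ r + fmtError b K a))
        = ENNReal.ofReal (characteristic f ⊤ r) * ENNReal.ofReal (fsWeight a)
          + ENNReal.ofReal (fsWeight a * fmtError b K a) := by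
      intro a
      have h1 := hT0 r hr
      have h2 := fsWeight_nonneg a
      have h3 := fmtError_nonneg b hK a
      rw [← ENNReal.ofReal_mul h1, ← ENNReal.ofReal_add (by positivity) (by positivity)]
      congr 1; ring
    simp_rw [this]
    rw [lintegral_add_left (by fun_prop), lintegral_const_mul _ (by fun_prop), lintegral_fsWeight,
      mul_one]
  -- The first main theorem at radii r and 1 gives T(r) ≤ N̄(r, a) + m(r, a) + T(1) + 2 `fmtError`
  -- for noncritical a ≠ b, m being the proximity function. Integrating against the weight of mass 1
  -- leaves bounded terms besides A(r).
  have hlower : ∀ r, 1 ≤ r → ENNReal.ofReal (characteristic f ⊤ r)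
      ≤ A r + (M + (ENNReal.ofReal (characteristic f ⊤ 1) + 2 * I)) := by
    intro r hr
    have hA' : A r = ∫⁻ a, ENNReal.ofReal (fsWeight a) * regularCounting f r a := by
      simp only [hA, fubiniStudyDensity_eq]
      simp_rw [fun z => ENNReal.ofReal_mul (fsWeight_nonneg (f z)) (q := ‖deriv f z‖ ^ 2)]
      exact lintegral_logWeight_mul_eq hf hnc hfs.ennreal_ofReal r
    have hpt : ∀ᵐ a : ℂ, ENNReal.ofReal (characteristic f ⊤ r) * ENNReal.ofReal (fsWeight a)
        ≤ ENNReal.ofReal (fsWeight a) * regularCounting f r a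
          + (ENNReal.ofReal (fsWeight a) * ENNReal.ofReal (proximity f a r)
            + (ENNReal.ofReal (characteristic f ⊤ 1) * ENNReal.ofReal (fsWeight a)
              + 2 * ENNReal.ofReal (fsWeight a * fmtError b K a))) := by
      have hb : ∀ᵐ a : ℂ, a ≠ b := by simp [ae_iff]
      have hcv : ∀ᵐ a : ℂ, a ∉ criticalValues f :=
        (countable_criticalValues hf hnc).ae_notMem volume
      filter_upwards [hb, hcv] with a ha hac
      have h1 := (abs_le.1 (hfmt a ha r (by linarith))).1
      have h2 := (abs_le.1 (hfmt a ha 1 one_ne_zero)).2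
      have h3 := proximity_nonneg (f := f) (a := a) 1
      simp only [Pi.zero_apply] at h3
      have h4 := logCounting_le_simpleCounting_add hf hnc hr hac
      have h5 : characteristic f ⊤ r ≤ simpleCounting f a r + (proximity f a r
          + (characteristic f ⊤ 1 + 2 * fmtError b K a)) := by linarith
      have h6 := fsWeight_nonneg a
      have h7 := fmtError_nonneg b hK a
      have h8 := proximity_nonneg (f := f) (a := a) r
      simp only [Pi.zero_apply] at h8
      have h9 := hT0 1 le_rfl
      have h10 := simpleCounting_nonneg hf hnc a hr
      have h11 : ENNReal.ofReal (characteristic f ⊤ r) ≤ regularCounting f r a +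
          (ENNReal.ofReal (proximity f a r) + (ENNReal.ofReal (characteristic f ⊤ 1)
            + 2 * ENNReal.ofReal (fmtError b K a))) := by
        refine (ENNReal.ofReal_le_ofReal h5).trans ?_
        rw [ENNReal.ofReal_add h10 (by positivity), ENNReal.ofReal_add h8 (by positivity),
          ENNReal.ofReal_add h9 (by positivity), ENNReal.ofReal_mul (by norm_num)]
        have := le_regularCounting hf hnc hr hac
        gcongr
        simp
      rw [ENNReal.ofReal_mul h6]
      calc _ ≤ _ := mul_le_mul_left h11 (ENNReal.ofReal (fsWeight a))
        _ = _ := by ring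
    have hint := lintegral_mono_ae hpt
    rw [lintegral_const_mul _ (by fun_prop), lintegral_fsWeight, mul_one] at hint
    refine hint.trans ?_
    have hrc := measurable_regularCounting f r
    rw [lintegral_add_left (by fun_prop), lintegral_add_right _ (by fun_prop),
      lintegral_add_left (by fun_prop), lintegral_const_mul _ (by fun_prop),
      lintegral_const_mul _ (by fun_prop), lintegral_fsWeight, mul_one, ← hA', ← hI]
    exact add_le_add le_rfl (add_le_add (lintegral_fsWeight_mul_proximity_le hf r) le_rfl)
  have hAfin : ∀ r, 1 ≤ r → A r < ⊤ := fun r hr =>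
    (hupper r hr).trans_lt (ENNReal.add_lt_top.2 ⟨ENNReal.ofReal_lt_top, hIfin⟩)
  have hfsm := measurable_fubiniStudyDensity hf
  have hfs0 : ∀ z, 0 ≤ fubiniStudyDensity f z := fun z => by
    rw [fubiniStudyDensity_eq]; exact mul_nonneg (fsWeight_nonneg _) (sq_nonneg _)
  have hball : ∀ r, ∫⁻ t in Ioc 1 r, (∫⁻ z in Metric.ball 0 t, ENNReal.ofReal
      (fubiniStudyDensity f z)) * ENNReal.ofReal t⁻¹ < ⊤ := by
    intro r
    rcases le_total 1 r with hr | hr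
    · rw [lintegral_setLIntegral_ball_div hfsm.ennreal_ofReal r hr]
      exact hAfin r hr
    · rw [Ioc_eq_empty (not_lt.2 hr)]; simp
  have hT : ∀ r, 1 ≤ r → ahlforsCharacteristic f r = (A r).toReal := fun r hr =>
    intervalIntegral_setIntegral_ball_div_eq hfsm hfs0 hball hr
  set L := M + (ENNReal.ofReal (characteristic f ⊤ 1) + 2 * I) with hL
  have hLfin : L ≠ ⊤ := by
    refine (ENNReal.add_lt_top.2 ⟨hMfin, ENNReal.add_lt_top.2 ⟨ENNReal.ofReal_lt_top, ?_⟩⟩).ne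
    exact ENNReal.mul_lt_top (by simp) hIfin
  refine ⟨max I.toReal L.toReal, fun r hr => ?_⟩
  rw [hT r hr, abs_le]
  have h1 := ENNReal.toReal_mono
    (ENNReal.add_lt_top.2 ⟨ENNReal.ofReal_lt_top, hIfin⟩).ne (hupper r hr)
  have h2 := ENNReal.toReal_mono
    (ENNReal.add_lt_top.2 ⟨hAfin r hr, hLfin.lt_top⟩).ne (hlower r hr)
  rw [ENNReal.toReal_add ENNReal.ofReal_ne_top hIfin.ne, ENNReal.toReal_ofReal (hT0 r hr)] at h1
  rw [ENNReal.toReal_add (hAfin r hr).ne hLfin, ENNReal.toReal_ofReal (hT0 r hr)] at h2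
  constructor
  · linarith [le_max_right I.toReal L.toReal]
  · linarith [le_max_left I.toReal L.toReal]

end

/-! ### Jensen's formula, concavity of the logarithm and the two circle means. -/

section
variable {f : ℂ → ℂ}

open ValueDistribution in
/-- The logarithmic average of the pulled back singular density grows at most like the
characteristic. -/
lemma exists_lintegral_singularDensity_le (hf : Meromorphic f) (hnc : MeromorphicNonconstant f)
    {b : ℂ} {K : ℝ} (hK : 0 ≤ K) (hfmt : ∀ a, a ≠ b → ∀ r : ℝ, r ≠ 0 →
      |logCounting f a r + proximity f a r - characteristic f ⊤ r| ≤ fmtError b K a)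
    {F : Finset ℂ} (hb : b ∈ F) :
    ∃ C : ℝ, 0 ≤ C ∧ ∀ r, 1 ≤ r → ∫⁻ z, ENNReal.ofReal (logWeight r z) *
        ENNReal.ofReal (singularDensity F (f z) * ‖deriv f z‖ ^ 2)
      ≤ ENNReal.ofReal (C * (characteristic f ⊤ r + 1)) := by
  set J := ∫⁻ w, ENNReal.ofReal (singularDensity F w * logSize F w) with hJ
  have hJfin : J < ⊤ := lintegral_singularDensity_mul_logSize_lt_top ⟨b, hb⟩
  -- log⁺|a| is itself at most |log|a - b|| plus constants, so `fmtError` contains at most two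
  -- copies of |log|a - b||; these account for the summand 2.
  set c := Real.posLog ‖b‖ + 2 * Real.log 2 + K + 2 with hc
  have hpb : 0 ≤ Real.posLog ‖b‖ := Real.posLog_nonneg
  have hl2 : 0 ≤ Real.log 2 := Real.log_nonneg (by norm_num)
  have hc1 : 1 ≤ c := by linarith
  refine ⟨c * J.toReal, by positivity, fun r hr => ?_⟩
  have hT : 0 ≤ characteristic f ⊤ r := characteristic_nonneg hr
  refine (lintegral_logWeight_mul_le hf hnc hfmt (measurable_singularDensity F)
    (singularDensity_nonneg F) hr).trans ?_
  have hpt : ∀ a, ENNReal.ofReal (singularDensity F a * (characteristic f ⊤ r + fmtError b K a))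
      ≤ ENNReal.ofReal (c * (characteristic f ⊤ r + 1))
        * ENNReal.ofReal (singularDensity F a * logSize F a) := by
    intro a
    have h1 := abs_log_le_logSize hb a
    have h0 := abs_nonneg (Real.log ‖a - b‖)
    rw [← ENNReal.ofReal_mul (by positivity)]
    refine ENNReal.ofReal_le_ofReal ?_
    rw [mul_left_comm]
    refine mul_le_mul_of_nonneg_left ?_ (singularDensity_nonneg F a)
    have h2 : Real.posLog ‖a‖ ≤ |Real.log ‖a - b‖| + Real.posLog ‖b‖ + Real.log 2 := by
      have h3 := Real.posLog_norm_add_le (a - b) b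
      rw [sub_add_cancel] at h3
      have h4 := abs_log_eq_posLog_add ‖a - b‖
      have h5 : 0 ≤ Real.posLog ‖a - b‖⁻¹ := Real.posLog_nonneg
      linarith
    have h3 : fmtError b K a ≤ c * logSize F a := by
      unfold fmtError
      have : 0 ≤ (Real.posLog ‖b‖ + 2 * Real.log 2 + K) * (logSize F a - 1) :=
        mul_nonneg (by positivity) (by linarith)
      simp only [hc]
      nlinarith
    have h4 : characteristic f ⊤ r ≤ characteristic f ⊤ r * (c * logSize F a) := by
      have : 1 ≤ c * logSize F a := one_le_mul_of_one_le_of_one_le hc1 (by linarith)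
      exact le_mul_of_one_le_right hT this
    nlinarith
  refine (lintegral_mono hpt).trans ?_
  rw [lintegral_const_mul' _ _ ENNReal.ofReal_ne_top, ← hJ, ← ENNReal.ofReal_toReal hJfin.ne,
    ← ENNReal.ofReal_mul (by positivity)]
  exact ENNReal.ofReal_le_ofReal (le_of_eq (by rw [ENNReal.toReal_ofReal (by positivity)]; ring))

/-- Half the logarithm of the pulled back singular density, up to the logarithmic correction. -/
noncomputable def logPullback (f : ℂ → ℂ) (F : Finset ℂ) (z : ℂ) : ℝ :=
  ((F.card - 1 : ℕ) : ℝ) * Real.posLog ‖f z‖ - ∑ b ∈ F, Real.log ‖f z - b‖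
    + Real.log ‖deriv f z‖

lemma circleIntegrable_log_norm_sub (hf : Meromorphic f) (b : ℂ) (r : ℝ) :
    CircleIntegrable (fun z => Real.log ‖f z - b‖) 0 r :=
  MeromorphicOn.circleIntegrable_log_norm fun z _ => (hf z).sub_const b

lemma circleIntegrable_sum_log (hf : Meromorphic f) (F : Finset ℂ) (r : ℝ) :
    CircleIntegrable (fun z => ∑ b ∈ F, Real.log ‖f z - b‖) 0 r :=
  CircleIntegrable.fun_sum F fun b _ => circleIntegrable_log_norm_sub hf b r

lemma circleIntegrable_posLog (hf : Meromorphic f) (r : ℝ) :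
    CircleIntegrable (fun z => Real.posLog ‖f z‖) 0 r :=
  hf.meromorphicOn.circleIntegrable_posLog_norm

lemma circleIntegrable_logPullback (hf : Meromorphic f) (F : Finset ℂ) (r : ℝ) :
    CircleIntegrable (logPullback f F) 0 r := by
  unfold logPullback
  refine CircleIntegrable.add (CircleIntegrable.sub ?_ (circleIntegrable_sum_log hf F r))
    (MeromorphicOn.circleIntegrable_log_norm fun z _ => hf.deriv z)
  exact (circleIntegrable_posLog hf r).const_mul _

open ValueDistribution Classical in
/-- Jensen's formula for `f - b` and `f'` gives the algebraic part of the second main theorem. -/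
lemma exists_characteristic_le_circleAverage (hf : Meromorphic f) (hnc : MeromorphicNonconstant f)
    {F : Finset ℂ} (hF : F.Nonempty) :
    ∃ C : ℝ, ∀ r, 1 ≤ r → ((F.card - 1 : ℕ) : ℝ) * characteristic f ⊤ r
      ≤ ∑ a ∈ insert OnePoint.infty (F.map ⟨_, OnePoint.coe_injective⟩), simpleCounting f a r
        + Real.circleAverage (logPullback f F) 0 r + C := by
  set c1 := ∑ b ∈ F, Real.log ‖meromorphicTrailingCoeffAt (fun w => f w - b) 0‖ with hc1
  set c2 := Real.log ‖meromorphicTrailingCoeffAt (deriv f) 0‖ with hc2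
  refine ⟨c1 - c2 - Function.locallyFinsuppWithin.logCounting (ramificationDivisor f F) 1,
    fun r hr => ?_⟩
  have hr0 : r ≠ 0 := by linarith
  have h1 := mul_sum_simpleCounting_le hf hnc (k := -1)
    (neg_sum_le_ramificationDivisor hf hnc hF) hr
  have h2 : Function.locallyFinsuppWithin.logCounting (ramificationDivisor f F) r
      = Function.locallyFinsuppWithin.logCounting (MeromorphicOn.divisor (deriv f) univ) r
        - ∑ b ∈ F, Function.locallyFinsuppWithin.logCounting
          (MeromorphicOn.divisor (fun w => f w - b) univ) r
        - ((F.card - 1 : ℕ) : ℝ) * logCounting f ⊤ r := by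
    simp [ramificationDivisor, logCounting_top]
  have h3 : Real.circleAverage (logPullback f F) 0 r
      = ((F.card - 1 : ℕ) : ℝ) * proximity f ⊤ r
        - ∑ b ∈ F, Real.circleAverage (fun z => Real.log ‖f z - b‖) 0 r
        + Real.circleAverage (fun z => Real.log ‖deriv f z‖) 0 r := by
    unfold logPullback
    rw [Real.circleAverage_fun_add, Real.circleAverage_fun_sub, Real.circleAverage_fun_sum,
      proximity_top, ← smul_eq_mul, ← Real.circleAverage_fun_smul]
    · rfl
    · exact fun b _ => circleIntegrable_log_norm_sub hf b r
    · exact (circleIntegrable_posLog hf r).const_mul _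
    · exact circleIntegrable_sum_log hf F r
    · exact ((circleIntegrable_posLog hf r).const_mul _).sub (circleIntegrable_sum_log hf F r)
    · exact MeromorphicOn.circleIntegrable_log_norm fun z _ => hf.deriv z
  have h4 : ∀ b ∈ F, Real.circleAverage (fun z => Real.log ‖f z - b‖) 0 r
      = Function.locallyFinsuppWithin.logCounting
          (MeromorphicOn.divisor (fun w => f w - b) univ) r
        + Real.log ‖meromorphicTrailingCoeffAt (fun w => f w - b) 0‖ := by
    intro b _
    rw [Function.locallyFinsuppWithin.logCounting_divisor_eq_circleAverage_sub_const
      (hf.sub_const b) hr0]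
    ring
  have h5 := Function.locallyFinsuppWithin.logCounting_divisor_eq_circleAverage_sub_const
      hf.deriv hr0
  rw [Finset.sum_congr rfl h4, Finset.sum_add_distrib] at h3
  -- The proximity term from `logPullback` and the pole term from the divisor carry the same factor
  -- |F| - 1 and recombine into the characteristic.
  simp only [characteristic, Pi.add_apply]
  simp only [Int.cast_neg, Int.cast_one] at h1
  rw [mul_add]
  linarith

lemma posLog_eq_log_max {x : ℝ} (hx : 0 ≤ x) : Real.posLog x = Real.log (max 1 x) := by
  rcases le_total x 1 with h | h
  · rw [max_eq_left h, Real.log_one, Real.posLog_eq_zero_iff, abs_of_nonneg hx]; exact h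
  · rw [max_eq_right h, Real.posLog_eq_log]; rwa [abs_of_nonneg hx]

/-- Separates the area density from its logarithmic correction, so that concavity can be applied to
each with its own mean. -/
lemma logPullback_eq {F : Finset ℂ} {z : ℂ} (hz : deriv f z ≠ 0) (hb : ∀ b ∈ F, f z ≠ b) :
    2 * logPullback f F z = Real.log (singularDensity F (f z) * ‖deriv f z‖ ^ 2)
      + 3 * Real.log (logSize F (f z)) := by
  have h1 : 0 < logSize F (f z) := zero_lt_one.trans_le (one_le_logSize F _)
  have h2 : 0 < max 1 ‖f z‖ := lt_max_of_lt_left one_pos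
  have h3 : ∀ b ∈ F, ‖f z - b‖ ^ 2 ≠ 0 := fun b hb' => by
    have := norm_pos_iff.2 (sub_ne_zero.2 (hb b hb'))
    positivity
  have h4 : 0 < ‖deriv f z‖ := norm_pos_iff.2 hz
  have h5 : ∏ b ∈ F, ‖f z - b‖ ^ 2 ≠ 0 := Finset.prod_ne_zero_iff.2 h3
  unfold logPullback singularDensity polarDensity
  rw [Real.log_mul (by positivity) (by positivity), Real.log_div (by positivity) (by positivity),
    Real.log_div (by positivity) h5, Real.log_prod h3, Real.log_pow, Real.log_pow, Real.log_pow,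
    posLog_eq_log_max (norm_nonneg _)]
  simp_rw [Real.log_pow]
  rw [← Finset.mul_sum]
  push_cast
  ring

lemma circleIntegrable_logSize (hf : Meromorphic f) (F : Finset ℂ) (r : ℝ) :
    CircleIntegrable (fun z => logSize F (f z)) 0 r := by
  unfold logSize
  refine CircleIntegrable.add (circleIntegrable_const _ _ _) ?_
  exact CircleIntegrable.fun_sum F fun b _ => (circleIntegrable_log_norm_sub hf b r).abs

/-- On a circle that avoids critical points, singularities and preimages of F, the integrand is
continuous; near a preimage of F it could blow up. -/
lemma circleIntegrable_singularDensity {F : Finset ℂ} {r : ℝ}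
    (hz : ∀ z, ‖z‖ = |r| → z ∈ regularSet f ∧ ∀ b ∈ F, f z ≠ b) :
    CircleIntegrable (fun z => singularDensity F (f z) * ‖deriv f z‖ ^ 2) 0 r := by
  refine ContinuousOn.circleIntegrable' fun z hzs => ContinuousAt.continuousWithinAt ?_
  obtain ⟨⟨h1, h2⟩, h3⟩ := hz z (by simpa using hzs)
  have hfz := h1.continuousAt
  have hdz := h1.deriv.continuousAt
  have h4 : ContinuousAt (logSize F) (f z) := by
    unfold logSize
    refine continuousAt_const.add (tendsto_finsetSum _ fun b hb => ?_)
    have : ‖f z - b‖ ≠ 0 := norm_ne_zero_iff.2 (sub_ne_zero.2 (h3 b hb))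
    exact ((by fun_prop : ContinuousAt (fun w : ℂ => ‖w - b‖) (f z)).log this).abs
  have h5 : ContinuousAt (singularDensity F) (f z) := by
    unfold singularDensity polarDensity
    refine ContinuousAt.div (ContinuousAt.div (by fun_prop) (by fun_prop) ?_) (h4.pow 3) ?_
    · refine Finset.prod_ne_zero_iff.2 fun b hb => ?_
      exact pow_ne_zero _ (norm_ne_zero_iff.2 (sub_ne_zero.2 (h3 b hb)))
    · exact pow_ne_zero _ (zero_lt_one.trans_le (one_le_logSize F _)).ne'
  exact (ContinuousAt.comp (f := f) h5 hfz).mul (hdz.norm.pow 2)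

/-- Concavity of the logarithm. -/
lemma circleAverage_logPullback_le (hf : Meromorphic f) {F : Finset ℂ} {r M M' : ℝ} (hM : 0 < M)
    (hM' : 0 < M') (hz : ∀ z, ‖z‖ = |r| → z ∈ regularSet f ∧ ∀ b ∈ F, f z ≠ b)
    (h1 : Real.circleAverage (fun z => singularDensity F (f z) * ‖deriv f z‖ ^ 2) 0 r ≤ M)
    (h2 : Real.circleAverage (fun z => logSize F (f z)) 0 r ≤ M') :
    2 * Real.circleAverage (logPullback f F) 0 r ≤ Real.log M + 3 * Real.log M' := by
  have hi1 := circleIntegrable_singularDensity hz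
  have hi2 := circleIntegrable_logSize hf F r
  have hi3 : CircleIntegrable
      (fun z => M⁻¹ * (singularDensity F (f z) * ‖deriv f z‖ ^ 2)) 0 r := hi1.const_mul _
  have hi4 : CircleIntegrable (fun z => 3 * M'⁻¹ * logSize F (f z)) 0 r := hi2.const_mul _
  have hi5 : CircleIntegrable (fun z => M⁻¹ * (singularDensity F (f z) * ‖deriv f z‖ ^ 2)
      + 3 * M'⁻¹ * logSize F (f z)) 0 r := hi3.add hi4
  -- The tangent line of log at m replaces Jensen's inequality: when the mean of x is at most m,
  -- averaging leaves log m. The constants -1 and 3 · (-1) make up the -4 below.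
  have hlog : ∀ x m : ℝ, 0 < x → 0 < m → Real.log x ≤ m⁻¹ * x - 1 + Real.log m := by
    intro x m hx hm
    have := Real.log_le_sub_one_of_pos (show 0 < m⁻¹ * x by positivity)
    rw [Real.log_mul (by positivity) hx.ne', Real.log_inv] at this
    linarith
  have hmono := Real.circleAverage_mono
    (f₁ := fun z => (2 : ℝ) * logPullback f F z)
    (f₂ := fun z => (M⁻¹ * (singularDensity F (f z) * ‖deriv f z‖ ^ 2)
      + 3 * M'⁻¹ * logSize F (f z)) + (Real.log M + 3 * Real.log M' - 4))
    (IntervalIntegrable.const_mul (circleIntegrable_logPullback hf F r) 2)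
    (hi5.add (circleIntegrable_const _ _ _)) ?_
  · rw [Real.circleAverage_fun_add hi5 (circleIntegrable_const _ _ _),
      Real.circleAverage_fun_add hi3 hi4, Real.circleAverage_const] at hmono
    simp_rw [← smul_eq_mul (a := M⁻¹), ← smul_eq_mul (a := 3 * M'⁻¹), ← smul_eq_mul (a := (2 : ℝ))]
      at hmono
    rw [Real.circleAverage_fun_smul, Real.circleAverage_fun_smul, Real.circleAverage_fun_smul]
      at hmono
    simp only [smul_eq_mul] at hmono
    have h3 : M⁻¹ * Real.circleAverage (fun z => singularDensity F (f z) * ‖deriv f z‖ ^ 2) 0 r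
        ≤ 1 := by
      rw [inv_mul_le_iff₀ hM]; linarith
    have h4 : M'⁻¹ * Real.circleAverage (fun z => logSize F (f z)) 0 r ≤ 1 := by
      rw [inv_mul_le_iff₀ hM']; linarith
    nlinarith
  · intro z hzs
    obtain ⟨⟨h3, h4⟩, h5⟩ := hz z (by simpa using hzs)
    have h6 : 0 < logSize F (f z) := zero_lt_one.trans_le (one_le_logSize F _)
    have h7 : 0 < singularDensity F (f z) * ‖deriv f z‖ ^ 2 := by
      have h8 : 0 < ‖deriv f z‖ := norm_pos_iff.2 h4
      have h9 : 0 < ∏ b ∈ F, ‖f z - b‖ ^ 2 := Finset.prod_pos fun b hb => by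
        have := norm_pos_iff.2 (sub_ne_zero.2 (h5 b hb))
        positivity
      unfold singularDensity polarDensity
      positivity
    rw [logPullback_eq h4 h5]
    have h8 := hlog _ _ h7 hM
    have h9 := hlog _ _ h6 hM'
    linarith

-- |log x| = log⁺ x + log⁺ (1/x), so the mean of |log|f - b|| is the sum of the proximity functions
-- of f - b at ∞ and of f at b, each at most T + O(1).
open ValueDistribution in
lemma exists_circleAverage_logSize_le (hf : Meromorphic f) (F : Finset ℂ) :
    ∃ C : ℝ, 0 < C ∧ ∀ r, 1 ≤ r → Real.circleAverage (fun z => logSize F (f z)) 0 r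
      ≤ C * (characteristic f ⊤ r + 1) := by
  set e : ℂ → ℝ := fun b => (Real.posLog ‖b‖ + Real.log 2) + (Real.posLog ‖b‖ + Real.log 2
    + |Real.log ‖meromorphicTrailingCoeffAt (fun w => f w - b) 0‖|) with he
  have hl2 : 0 ≤ Real.log 2 := Real.log_nonneg (by norm_num)
  have he0 : ∀ b, 0 ≤ e b := fun b => by
    have : 0 ≤ Real.posLog ‖b‖ := Real.posLog_nonneg
    simp only [he]; positivity
  have hse : 0 ≤ ∑ b ∈ F, e b := Finset.sum_nonneg fun b _ => he0 b
  refine ⟨1 + ∑ b ∈ F, e b + 2 * F.card, by positivity, fun r hr => ?_⟩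
  have hT : 0 ≤ characteristic f ⊤ r := characteristic_nonneg hr
  have h1 : ∀ b, Real.circleAverage (fun z => |Real.log ‖f z - b‖|) 0 r
      ≤ 2 * characteristic f ⊤ r + e b := by
    intro b
    have hi1 : CircleIntegrable (fun z => Real.posLog ‖f z - b‖) 0 r :=
      circleIntegrable_posLog (hf.sub_const b) r
    have hi2 : CircleIntegrable (fun z => Real.posLog ‖f z - b‖⁻¹) 0 r := by
      have := circleIntegrable_posLog (hf.sub_const b).inv r
      simpa using this
    simp_rw [abs_log_eq_posLog_add]
    rw [Real.circleAverage_fun_add hi1 hi2]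
    have h2 : Real.circleAverage (fun z => Real.posLog ‖f z - b‖) 0 r
        ≤ characteristic (fun z => f z - b) ⊤ r := by
      have : 0 ≤ logCounting (fun z => f z - b) ⊤ r := logCounting_nonneg hr
      simp only [characteristic, Pi.add_apply, proximity_top]
      linarith
    have h3 := (abs_le.1 (abs_characteristic_sub_characteristic_shift_le (r := r) (a₀ := b) hf)).1
    have h4 := (abs_le.1 (abs_logCounting_add_proximity_sub_characteristic_le hf b
      (by linarith : r ≠ 0))).2
    have h5 : 0 ≤ logCounting f b r := logCounting_nonneg hr
    have h6 : Real.circleAverage (fun z => Real.posLog ‖f z - b‖⁻¹) 0 r = proximity f b r := by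
      rw [proximity_coe]
    simp only [he]
    linarith
  have habs : ∀ b ∈ F, CircleIntegrable (fun z => |Real.log ‖f z - b‖|) 0 r :=
    fun b _ => (circleIntegrable_log_norm_sub hf b r).abs
  unfold logSize
  rw [Real.circleAverage_fun_add (circleIntegrable_const _ _ _)
    (CircleIntegrable.fun_sum F habs), Real.circleAverage_const,
    Real.circleAverage_fun_sum habs]
  have h2 := Finset.sum_le_sum fun b (_ : b ∈ F) => h1 b
  rw [Finset.sum_add_distrib, Finset.sum_const, nsmul_eq_mul] at h2
  have hc : (0 : ℝ) ≤ F.card := Nat.cast_nonneg _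
  nlinarith [mul_nonneg hse hT]

lemma circleAverage_le_of_lintegral_le {u : ℂ → ℝ} (hu : ∀ z, 0 ≤ u z) (hum : Measurable u) {r M : ℝ}
    (hM : 0 ≤ M)
    (h : ∫⁻ θ in Ioo (-Real.pi) Real.pi, ENNReal.ofReal (u (circleMap 0 r θ)) ≤ ENNReal.ofReal M) :
    Real.circleAverage u 0 r ≤ M := by
  have h1 : Real.circleAverage u 0 r
      = (2 * Real.pi)⁻¹ * ∫ θ in Ioo (-Real.pi) Real.pi, u (circleMap 0 r θ) := by
    rw [Real.circleAverage_eq_integral_add (-Real.pi), smul_eq_mul,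
      intervalIntegral.integral_comp_add_right (fun θ => u (circleMap 0 r θ)), zero_add,
      show 2 * Real.pi + -Real.pi = Real.pi by ring,
      intervalIntegral.integral_of_le (by linarith [Real.pi_pos]), integral_Ioc_eq_integral_Ioo]
  have h2 : ∫ θ in Ioo (-Real.pi) Real.pi, u (circleMap 0 r θ) ≤ M := by
    rw [integral_eq_lintegral_of_nonneg_ae (ae_of_all _ fun θ => hu _)
      (hum.comp (continuous_circleMap 0 r).measurable).aestronglyMeasurable]
    exact ENNReal.toReal_le_of_le_ofReal hM h
  have h3 : (2 * Real.pi)⁻¹ ≤ 1 := inv_le_one_of_one_le₀ (by linarith [Real.pi_gt_three])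
  rw [h1]
  have h4 : 0 ≤ ∫ θ in Ioo (-Real.pi) Real.pi, u (circleMap 0 r θ) := integral_nonneg fun θ => hu _
  have h5 : 0 ≤ (2 * Real.pi)⁻¹ := by positivity
  nlinarith

end

/-! ### Exceptional radii and assembly of the estimates. -/

section
variable {f : ℂ → ℂ}

/-- The radii of the circles that meet a non-regular point of `f` or a point of `f ⁻¹' F`. -/
def exceptionalRadii (f : ℂ → ℂ) (F : Finset ℂ) : Set ℝ :=
  norm '' {z | ¬ (z ∈ regularSet f ∧ ∀ b ∈ F, f z ≠ b)}

lemma countable_exceptionalRadii (hf : Meromorphic f) (hnc : MeromorphicNonconstant f)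
    (F : Finset ℂ) : (exceptionalRadii f F).Countable := by
  refine Countable.image (countable_compl_of_mem_codiscrete
    (s := {z | z ∈ regularSet f ∧ ∀ b ∈ F, f z ≠ b}) ?_) _
  refine inter_mem (regularSet_mem_codiscrete hf hnc) ?_
  refine (Filter.eventually_all_finset F).2 fun b _ => ?_
  filter_upwards [eventually_codiscrete_ne_zero (hf.sub_const b)
    (meromorphicOrderAt_sub_ne_top hf hnc b)] with z hz
  exact sub_ne_zero.1 hz

open ValueDistribution Classical in
/-- The truncated second main theorem for a suitable finite set of targets. -/
lemma exists_mul_characteristic_le (hf : Meromorphic f) (hnc : MeromorphicNonconstant f) :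
    ∃ b : ℂ, ∀ F : Finset ℂ, b ∈ F → ∃ C : ℝ, ∀ ε : ℝ, 0 < ε → ε ≤ 1 →
      ∃ E : Set ℝ, MeasurableSet E ∧ volume E < ⊤ ∧ ∀ r, 1 < r → r ∉ E →
        ((F.card - 1 : ℕ) : ℝ) * characteristic f ⊤ r
          ≤ ∑ a ∈ insert OnePoint.infty (F.map ⟨_, OnePoint.coe_injective⟩), simpleCounting f a r
            + 4 * Real.log (1 + characteristic f ⊤ r) + ε * Real.log r + C := by
  obtain ⟨b, K, hK, hfmt⟩ := exists_fmtError hf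
  refine ⟨b, fun F hb => ?_⟩
  obtain ⟨C₁, hC₁, h₁⟩ := exists_lintegral_singularDensity_le hf hnc hK hfmt hb
  obtain ⟨C₂, hC₂, h₂⟩ := exists_circleAverage_logSize_le hf F
  obtain ⟨C₃, h₃⟩ := exists_characteristic_le_circleAverage hf hnc ⟨b, hb⟩
  -- Half of the constants in log M + 3 log M', where M and M' bound the means of u and of `logSize
  -- ∘ f`. The same sum yields (4 + 3)/2 ≤ 4 copies of log(1 + T) and ε/2 ≤ ε copies of log r.
  refine ⟨C₃ + (Real.log 4 + 4 * Real.log (1 + C₁) + 3 * Real.log C₂) / 2, fun ε hε hε1 => ?_⟩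
  set u : ℂ → ℝ := fun z => singularDensity F (f z) * ‖deriv f z‖ ^ 2 with hu
  have hu0 : ∀ z, 0 ≤ u z := fun z => mul_nonneg (singularDensity_nonneg F _) (sq_nonneg _)
  have hum : Measurable u := ((measurable_singularDensity F).comp hf.measurable).mul
    (hf.deriv.measurable.norm.pow_const 2)
  have hH : ∀ r, 1 ≤ r →
      ∫⁻ t in Ioc 1 r, (∫⁻ z in Metric.ball 0 t, ENNReal.ofReal (u z)) * ENNReal.ofReal t⁻¹
      ≤ ENNReal.ofReal (C₁ * (characteristic f ⊤ r + 1)) := fun r hr => by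
    rw [lintegral_setLIntegral_ball_div hum.ennreal_ofReal r hr]
    exact h₁ r hr
  obtain ⟨E, hEm, hEv, hE⟩ := exists_lintegral_circle_le hum.ennreal_ofReal (fun r => by
    rcases le_total 1 r with hr | hr
    · exact (hH r hr).trans_lt ENNReal.ofReal_lt_top
    · simp [Ioc_eq_empty (not_lt.2 hr)]) hε hε1
  have hcount := countable_exceptionalRadii hf hnc F
  refine ⟨E ∪ exceptionalRadii f F, hEm.union hcount.measurableSet,
    (measure_union_le _ _).trans_lt (by rw [hcount.measure_zero, add_zero]; exact hEv),
    fun r hr hrE => ?_⟩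
  rw [mem_union, not_or] at hrE
  have hT : 0 ≤ characteristic f ⊤ r := characteristic_nonneg hr.le
  have hr0 : 0 < r := by linarith
  have hz : ∀ z, ‖z‖ = |r| → z ∈ regularSet f ∧ ∀ b ∈ F, f z ≠ b := fun z hzr => by
    by_contra hcon
    exact hrE.2 ⟨z, hcon, hzr.trans (abs_of_pos hr0)⟩
  have hM : Real.circleAverage u 0 r
      ≤ 4 * r ^ ε * ((1 + C₁) * (1 + characteristic f ⊤ r)) ^ 4 := by
    refine circleAverage_le_of_lintegral_le hu0 hum (by positivity) ((hE r hr hrE.1).trans ?_)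
    rw [ENNReal.ofReal_mul (by positivity), ENNReal.ofReal_mul (by positivity),
      ENNReal.ofReal_ofNat, ENNReal.ofReal_pow (by positivity)]
    gcongr
    calc _ ≤ 1 + ENNReal.ofReal (C₁ * (characteristic f ⊤ r + 1)) := by gcongr; exact hH r hr.le
      _ = ENNReal.ofReal (1 + C₁ * (characteristic f ⊤ r + 1)) := by
        rw [ENNReal.ofReal_add zero_le_one (by positivity), ENNReal.ofReal_one]
      _ ≤ _ := ENNReal.ofReal_le_ofReal (by nlinarith)
  have h4 := circleAverage_logPullback_le hf (by positivity) (by positivity) hz hM (h₂ r hr.le)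
  rw [Real.log_mul (by positivity) (by positivity), Real.log_mul (by positivity) (by positivity),
    Real.log_rpow hr0, Real.log_pow, Real.log_mul (by positivity) (by positivity),
    Real.log_mul (by positivity) (by positivity), add_comm (characteristic f ⊤ r)] at h4
  push_cast at h4
  have h5 := h₃ r hr.le
  have h6 : 0 ≤ Real.log (1 + characteristic f ⊤ r) := Real.log_nonneg (by linarith)
  have h7 : 0 ≤ ε * Real.log r := mul_nonneg hε.le (Real.log_nonneg hr.le)
  linarith

lemma exists_sum_simpleCounting_le (hf : Meromorphic f) (hnc : MeromorphicNonconstant f)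
    (S : Finset (OnePoint ℂ)) : ∃ K : ℝ, ∀ r, 1 ≤ r →
      ∑ a ∈ S, simpleCounting f a r ≤ S.card * ValueDistribution.characteristic f ⊤ r + K := by
  choose K hK using exists_simpleCounting_le hf hnc
  refine ⟨∑ a ∈ S, K a, fun r hr => (Finset.sum_le_sum fun a _ => hK a r hr).trans_eq ?_⟩
  rw [Finset.sum_add_distrib, Finset.sum_const, nsmul_eq_mul]

-- The targets are enlarged to a set B containing ∞ and the special point b, so that |F| - 1 = |B| -
-- 2. Each of the |B| - |A| extra targets adds at most T + O(1) on the right, which is exactly the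
-- drop in the coefficient on the left.
open ValueDistribution in
lemma exists_sub_two_mul_characteristic_le (hf : Meromorphic f) (hnc : MeromorphicNonconstant f)
    (A : Finset (OnePoint ℂ)) : ∃ C : ℝ, ∀ ε : ℝ, 0 < ε → ε ≤ 1 →
      ∃ E : Set ℝ, MeasurableSet E ∧ volume E < ⊤ ∧ ∀ r, 1 < r → r ∉ E →
        ((A.card : ℝ) - 2) * characteristic f ⊤ r ≤ ∑ a ∈ A, simpleCounting f a r
          + 4 * Real.log (1 + characteristic f ⊤ r) + ε * Real.log r + C := by
  classical
  obtain ⟨b, hb⟩ := exists_mul_characteristic_le hf hnc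
  set F : Finset ℂ := insert b (A.preimage _ OnePoint.coe_injective.injOn) with hF
  set B : Finset (OnePoint ℂ) :=
    insert OnePoint.infty (F.map ⟨_, OnePoint.coe_injective⟩) with hB
  obtain ⟨C, hC⟩ := hb F (Finset.mem_insert_self _ _)
  have hAB : A ⊆ B := by
    intro a ha
    induction a using OnePoint.rec with
    | infty => exact Finset.mem_insert_self _ _
    | coe c =>
      refine Finset.mem_insert_of_mem (Finset.mem_map.2 ⟨c, ?_, rfl⟩)
      exact Finset.mem_insert_of_mem (Finset.mem_preimage.2 ha)
  have hcard : B.card = F.card + 1 := by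
    rw [hB, Finset.card_insert_of_notMem (by simp), Finset.card_map]
  have hFpos : 1 ≤ F.card := Finset.card_pos.2 ⟨b, Finset.mem_insert_self _ _⟩
  obtain ⟨K, hK⟩ := exists_sum_simpleCounting_le hf hnc (B \ A)
  refine ⟨C + K, fun ε hε hε1 => ?_⟩
  obtain ⟨E, hEm, hEv, hE⟩ := hC ε hε hε1
  refine ⟨E, hEm, hEv, fun r hr hrE => ?_⟩
  have h1 := hE r hr hrE
  have h2 := hK r hr.le
  rw [← hB, ← Finset.sum_sdiff hAB, Nat.cast_sub hFpos] at h1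
  rw [Finset.card_sdiff_of_subset hAB, Nat.cast_sub (Finset.card_le_card hAB), hcard] at h2
  push_cast at h1 h2
  linarith

end

theorem corollaryI (f : ℂ → ℂ) (hf : Meromorphic f) (hnc : MeromorphicNonconstant f)
    (q : ℕ) (a : Fin q → OnePoint ℂ) (ha : Function.Injective a) :
    ∃ C : ℝ, 0 < C ∧ ∀ δ : ℝ, 0 < δ →
      ∃ E : Set ℝ, MeasurableSet E ∧ volume E < ⊤ ∧
        ∀ r : ℝ, 0 < r → r ∉ E →
          0 < ahlforsCharacteristic f r ∧
          ((q : ℝ) - 2) * ahlforsCharacteristic f r ≤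
            (∑ j : Fin q, simpleCounting f (a j) r) +
              C * (Real.log (ahlforsCharacteristic f r) + δ * Real.log r) := by
  obtain ⟨C, hC⟩ := exists_sub_two_mul_characteristic_le hf hnc (Finset.univ.map ⟨a, ha⟩)
  obtain ⟨C₀, hC₀⟩ := exists_abs_ahlforsCharacteristic_sub_le hf hnc
  set D := 4 * Real.log 2 + C + |(q : ℝ) - 2| * C₀ with hD
  -- Beyond r₀ the Ahlfors characteristic S is at least C₀ + 1 + exp D, whence S > 0, 1 + T ≤ 2S and
  -- D ≤ log S.
  obtain ⟨r₀, hr₀⟩ := eventually_atTop.1 (tendsto_atTop.1 (tendsto_characteristic_atTop hf hnc)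
    (2 * C₀ + 1 + Real.exp D))
  -- Four copies of log S come from 4 log(1 + T), and a fifth absorbs the additive constant D.
  refine ⟨5, by norm_num, fun δ hδ => ?_⟩
  obtain ⟨E, hEm, hEv, hE⟩ := hC (min δ 1) (lt_min hδ one_pos) (min_le_right _ _)
  -- Small radii, where T_f may fail to be positive, are put into the exceptional set.
  refine ⟨E ∪ Icc 0 (max r₀ 1), hEm.union measurableSet_Icc,
    (measure_union_le _ _).trans_lt (ENNReal.add_lt_top.2 ⟨hEv, measure_Icc_lt_top⟩),
    fun r hr hrE => ?_⟩
  rw [mem_union, not_or, mem_Icc, not_and, not_le] at hrE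
  obtain ⟨hrr₀, hr1⟩ := max_lt_iff.1 (hrE.2 hr.le)
  have h1 := hE r hr1 hrE.1
  have h2 := abs_le.1 (hC₀ r hr1.le)
  have h3 := hr₀ r hrr₀.le
  simp only [Finset.card_map, Finset.card_univ, Fintype.card_fin, Finset.sum_map,
    Function.Embedding.coeFn_mk] at h1
  set S := ahlforsCharacteristic f r
  set T := ValueDistribution.characteristic f ⊤ r
  have hC₀0 : 0 ≤ C₀ := (abs_nonneg _).trans (hC₀ r hr1.le)
  have hexp := Real.exp_pos D
  have hS : 0 < S := by linarith
  have hT : 0 < 1 + T := by linarith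
  refine ⟨hS, ?_⟩
  have h4 : Real.log (1 + T) ≤ Real.log 2 + Real.log S := by
    rw [← Real.log_mul two_ne_zero hS.ne']
    exact Real.log_le_log hT (by linarith)
  have h5 : D ≤ Real.log S := (Real.le_log_iff_exp_le hS).2 (by linarith)
  have h6 : ((q : ℝ) - 2) * (S - T) ≤ |(q : ℝ) - 2| * C₀ := by
    refine (le_abs_self _).trans ?_
    rw [abs_mul]
    exact mul_le_mul_of_nonneg_left (hC₀ r hr1.le) (abs_nonneg _)
  have h7 : min δ 1 * Real.log r ≤ 5 * (δ * Real.log r) := by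
    have hlog := Real.log_nonneg hr1.le
    nlinarith [mul_le_mul_of_nonneg_right (min_le_left δ 1) hlog, mul_nonneg hδ.le hlog]
  linarith
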